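/- **Setting.** Let $N=k+1\ge 1$, let $\mathcal D\subseteq\mathbb R^N$ be open, $f_0\in C^2(\mathcal D;\mathbb R^N)$, $\delta>0$, $T>0$, and let $f_1\in C^2(\mathcal D\times\mathbb R\times(-\delta,\delta);\mathbb R^N)$ be $T$-periodic in its second argument $t$. Consider $$\dot x=f_0(x)+\epsilon f_1(x,t;\epsilon).\qquad(1)$$ Assume that the unperturbed system $\dot x=f_0(x)$ is completely integrable with periodic orbits, in the following sense. * There is a $C^2$ submersion $I=(I_1,\dots,I_{N-1}):\mathcal D\to\mathbb R^{N-1}$ whose components are constant along the solutions; put $\Lambda=I(\mathcal D)$. * Every solution starting at a point $x\in\mathcal D$ stays in $\mathcal D$ and is periodic with least positive period $P(x)$, and $P\in C^1(\mathcal D;\mathbb R)$. * There is a $C^2$ hypersurface $\mathcal D_0\subset\mathcal D$, transverse to $f_0$, that meets every orbit in exactly one point and every level set $I^{-1}(\xi)$, $\xi\in\Lambda$, in exactly one point $x_0(\xi)$. Write $P(\xi)=P(x_0(\xi))$ and $\Omega(\xi)=T/P(\xi)$ for $\xi\in\Lambda$; let $q(t,\xi)$ be the solution of $\dot x=f_0(x)$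 with $q(0,\xi)=x_0(\xi)$, and let $G(\xi,\theta)=q\big(\tfrac{P(\xi)}{T}\theta,\xi\big)$ for $\theta\in\mathbb R$. For a positive integer $n$ and $z_0=(I_0,\theta_0)\in\Lambda\times\mathbb R$, put $\gamma(t)=G(I_0,\theta_0+\Omega(I_0)t)$ and define the Melnikov vector $(M_1,\dots,M_N)$ at $z_0$ by $$M_i=\int_0^{nT}DI_i(\gamma(t))\,f_1(\gamma(t),t;0)\,dt,\qquad i=1,\dots,N-1,$$ $$M_N=\sum_{i=1}^{N-1}\frac{\partial\Omega}{\partial I_i}(I_0)\int_0^{nT}\!\!\int_0^t DI_i(\gamma(s))f_1(\gamma(s),s;0)\,ds\,dt+\int_0^{nT}\Omega(I_0)\frac{f_0(\gamma)\cdot f_1(\gamma,t;0)}{|f_0(\gamma)|^2}\,dt-\int_0^{nT}\Omega(I_0)\sum_{i=1}^{N-1}\frac{f_0(\gamma)\cdot G_{I_i}(I_0,\theta_0+\Omega(I_0)t)}{|f_0(\gamma)|^2}\,DI_i(\gamma)f_1(\gamma,t;0)\,dt,$$ where $\gamma=\gamma(t)$ in the last two integrals. **Theorem 1.** Let $z_0^*=(I_0^*,\theta_0^*)\in\Lambda\times\mathbb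 R$ satisfy the resonance condition $m\,P(I_0^*)=n\,T$ for certain positive integers $m,n$, and assume that one of the following holds. (a) Non-degenerate case: $\frac{d\Omega}{dI}(I_0^*)\ne0$, $M_i(z_0^*)=0$ for $i=1,\dots,N-1$, and $\det\frac{\partial(M_1,\dots,M_{N-1},\Omega)}{\partial(I_0,\theta_0)}(z_0^*)\ne0$. (b) Degenerate case (locally constant period): $\frac{d\Omega}{dI}=0$ on a neighbourhood of $I_0^*$, $M_i(z_0^*)=0$ for $i=1,\dots,N$, and $\det\frac{\partial(M_1,\dots,M_N)}{\partial(I_0,\theta_0)}(z_0^*)\ne0$. Then there are points $x_0^*(\epsilon)$ with $x_0^*(\epsilon)\to G(z_0^*)$ as $\epsilon\to0^+$ such that, for all sufficiently small $\epsilon>0$, system (1) has a periodic solution $x(t)\in\mathcal D$, $t\in\mathbb R$, with period $nT$ and $x(0)=x_0^*(\epsilon)$. -/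

import Mathlib

open Set Filter Topology

/-- The phase space `ℝ^N` with its Euclidean structure, where `N = k + 1`. -/
abbrev Phase (k : ℕ) : Type := EuclideanSpace ℝ (Fin (k + 1))

/-- `S` is, near each of its points, a `C²` hypersurface `{g = 0}` to which the vector field `f`
is transverse: the derivative of `g` does not vanish on `f p`, so `{g = 0}` is regular at `p`, its
tangent space there is the kernel of that derivative, and `f p` is not tangent. -/
def IsTransverseHypersurface {k : ℕ} (S : Set (Phase k)) (f : Phase k → Phase k) : Prop :=
  ∀ p ∈ S, ∃ (U : Set (Phase k)) (g : Phase k → ℝ), IsOpen U ∧ p ∈ U ∧ ContDiffOn ℝ 2 g U ∧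
    S ∩ U = {x ∈ U | g x = 0} ∧ fderiv ℝ g p (f p) ≠ 0

/-- A completely integrable system `x' = f₀(x)` on an open set `D ⊆ ℝ^N`, `N = k + 1`, with
`N - 1 = k` independent first integrals, all of whose solutions in `D` are periodic, together with
an initial value manifold. -/
structure PeriodicIntegrableSystem (k : ℕ) where
  /-- the open domain of the system -/
  D : Set (Phase k)
  /-- the vector field -/
  f₀ : Phase k → Phase k
  /-- the vector `(I₁, …, I_{N-1})` of first integrals -/
  I : Phase k → (Fin k → ℝ)
  /-- `flow t x` is the value at time `t` of the solution starting at `x` -/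
  flow : ℝ → Phase k → Phase k
  /-- the period of the orbit through a point -/
  P : Phase k → ℝ
  /-- the initial value manifold -/
  D₀ : Set (Phase k)
  isOpen_D : IsOpen D
  contDiffOn_f₀ : ContDiffOn ℝ 2 f₀ D
  flow_zero : ∀ x ∈ D, flow 0 x = x
  flow_mem : ∀ x ∈ D, ∀ t, flow t x ∈ D
  hasDerivAt_flow : ∀ x ∈ D, ∀ t, HasDerivAt (fun s => flow s x) (f₀ (flow t x)) t
  contDiffOn_I : ContDiffOn ℝ 2 I D
  /-- the integrals are functionally independent: `I` is a submersion -/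
  submersion_I : ∀ x ∈ D, Function.Surjective (fderiv ℝ I x)
  /-- the integrals are constant along solutions -/
  I_flow : ∀ x ∈ D, ∀ t, I (flow t x) = I x
  /-- every solution is periodic, with least positive period `P x` -/
  isLeast_P : ∀ x ∈ D, IsLeast {τ : ℝ | 0 < τ ∧ flow τ x = x} (P x)
  contDiffOn_P : ContDiffOn ℝ 1 P D
  D₀_subset : D₀ ⊆ D
  transverse_D₀ : IsTransverseHypersurface D₀ f₀
  /-- every orbit meets the initial value manifold in exactly one point -/
  orbit_inter_D₀ : ∀ x ∈ D, ∃! p, p ∈ D₀ ∧ ∃ t, flow t x = p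
  /-- each level set of `I` meets the initial value manifold in at most one point -/
  injOn_I : InjOn I D₀

namespace PeriodicIntegrableSystem

variable {k : ℕ} (S : PeriodicIntegrableSystem k)

/-- The set `Λ = I(D)` of values of the integrals. -/
def Lam : Set (Fin k → ℝ) := S.I '' S.D

/-- For `ξ ∈ Λ`, the point `x₀(ξ)` in which `I⁻¹(ξ)` meets the initial value manifold. -/
noncomputable def x₀ (ξ : Fin k → ℝ) : Phase k := Function.invFunOn S.I S.D₀ ξ

/-- The period as a function of the integrals. -/
noncomputable def period (ξ : Fin k → ℝ) : ℝ := S.P (S.x₀ ξ)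

/-- The frequency `Ω(I) = T / P(I)`. -/
noncomputable def Omega (T : ℝ) (ξ : Fin k → ℝ) : ℝ := T / S.period ξ

/-- The change of variables `G(I, θ) = q(λ θ, I)`, where `λ = P(I) / T` and `q(·, I)` is the
unperturbed solution starting at `x₀(I)`. -/
noncomputable def G (T : ℝ) (z : (Fin k → ℝ) × ℝ) : Phase k :=
  S.flow (S.period z.1 / T * z.2) (S.x₀ z.1)

/-- The unperturbed solution through `G(z)`: in the variables `(I, θ)`, `I` is constant and `θ`
grows linearly with speed `Ω(I)`. -/
noncomputable def orbit (T : ℝ) (z : (Fin k → ℝ) × ℝ) (t : ℝ) : Phase k :=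
  S.G T (z.1, z.2 + S.Omega T z.1 * t)

/-- The partial derivative `∂G/∂Iᵢ`. -/
noncomputable def dG (T : ℝ) (i : Fin k) (z : (Fin k → ℝ) × ℝ) : Phase k :=
  fderiv ℝ (fun ξ => S.G T (ξ, z.2)) z.1 (Pi.single i 1)

/-- `DIᵢ · f₁` at time `t` along the unperturbed solution through `G(z)`, for `ε = 0`. -/
noncomputable def dIf (f₁ : Phase k → ℝ → ℝ → Phase k) (T : ℝ) (z : (Fin k → ℝ) × ℝ)
    (i : Fin k) (t : ℝ) : ℝ :=
  fderiv ℝ S.I (S.orbit T z t) (f₁ (S.orbit T z t) t 0) i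

/-- The components `M₁, …, M_{N-1}` of the Melnikov vector. -/
noncomputable def melnikovI (f₁ : Phase k → ℝ → ℝ → Phase k) (T : ℝ) (n : ℕ)
    (z : (Fin k → ℝ) × ℝ) : Fin k → ℝ :=
  fun i => ∫ t in (0 : ℝ)..(n * T), S.dIf f₁ T z i t

/-- The last component `M_N` of the Melnikov vector. -/
noncomputable def melnikovTheta (f₁ : Phase k → ℝ → ℝ → Phase k) (T : ℝ) (n : ℕ)
    (z : (Fin k → ℝ) × ℝ) : ℝ :=
  (∑ i, fderiv ℝ (S.Omega T) z.1 (Pi.single i 1) *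
      ∫ t in (0 : ℝ)..(n * T), ∫ s in (0 : ℝ)..t, S.dIf f₁ T z i s)
  + (∫ t in (0 : ℝ)..(n * T), S.Omega T z.1 *
      (inner ℝ (S.f₀ (S.orbit T z t)) (f₁ (S.orbit T z t) t 0) / ‖S.f₀ (S.orbit T z t)‖ ^ 2))
  - ∫ t in (0 : ℝ)..(n * T), S.Omega T z.1 *
      ∑ i, inner ℝ (S.f₀ (S.orbit T z t)) (S.dG T i (z.1, z.2 + S.Omega T z.1 * t)) /
        ‖S.f₀ (S.orbit T z t)‖ ^ 2 * S.dIf f₁ T z i t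

/-- Non-degenerate case: `dΩ/dI ≠ 0`, `M₁ = … = M_{N-1} = 0` at `z`, and the Jacobian determinant
of `(M₁, …, M_{N-1}, Ω)` with respect to `(I, θ)` is non-zero at `z`. -/
def NonDegenerate (f₁ : Phase k → ℝ → ℝ → Phase k) (T : ℝ) (n : ℕ)
    (z : (Fin k → ℝ) × ℝ) : Prop :=
  fderiv ℝ (S.Omega T) z.1 ≠ 0 ∧
  (∀ i, S.melnikovI f₁ T n z i = 0) ∧
  (fderiv ℝ (fun w : (Fin k → ℝ) × ℝ => (S.melnikovI f₁ T n w, S.Omega T w.1)) z).det ≠ 0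

/-- Degenerate case: `dΩ/dI = 0` for all values of the integrals near `z.1`,
`M₁ = … = M_N = 0` at `z`, and the Jacobian determinant of `(M₁, …, M_N)` with respect to `(I, θ)`
is non-zero at `z`. -/
def Degenerate (f₁ : Phase k → ℝ → ℝ → Phase k) (T : ℝ) (n : ℕ)
    (z : (Fin k → ℝ) × ℝ) : Prop :=
  (∀ᶠ ξ in 𝓝 z.1, fderiv ℝ (S.Omega T) ξ = 0) ∧
  (∀ i, S.melnikovI f₁ T n z i = 0) ∧ S.melnikovTheta f₁ T n z = 0 ∧
  (fderiv ℝ (fun w : (Fin k → ℝ) × ℝ =>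
    (S.melnikovI f₁ T n w, S.melnikovTheta f₁ T n w)) z).det ≠ 0

end PeriodicIntegrableSystem

-- The points of the domain are written as q(s, I): the first integrals I together with the time s
-- along the unperturbed orbit, starting from the section (`timeChart`). In these coordinates the
-- unperturbed field is the constant e = (0, 1), and the perturbed equation reads z' = e + ε R
-- (`drift`, `hasDerivWithinAt_timeChart_comp`). Time is preferred to the angle θ because P, and
-- hence G, is only assumed C¹, whereas `timeChart` is C²; its derivative enters R, which is
-- therefore C¹.
--
-- Substituting z = ζ + t e + ε w removes the factor ε: w solves an equation that is regular at ε =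
-- 0. Thus w(nT) is C¹ in (ζ, ε) and equals the integral of R along the unperturbed solution when ε
-- = 0 (`exists_scaled_displacement`). The chart has period P(I) in s, so the solution closes up
-- after time nT as soon as w_I = 0 and nT + ε w_s = m P(I). These are N equations in ζ with
-- parameter ε. At ε = 0 the first group is M_1 = ... = M_{N-1} = 0. In the non-degenerate case the
-- last equation becomes Ω = m/n. In the degenerate case it holds at order zero because mP = nT near
-- I_0, and division by ε leaves w_s = 0, where Ω w_s = M_N at ε = 0
-- (`Omega_mul_integral_drift_snd`). The determinant condition and the implicit function theorem
-- give the root (`exists_tendsto_zero_of_det_ne_zero`).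
--
-- Smooth dependence on initial data is obtained from the inverse function theorem in C([0, 1], E),
-- applied to the integral equation (`exists_family_of_solutions`).

universe u

/-! ### Composition operators on spaces of continuous functions -/

section Nemytskii

variable {K : Type*} [TopologicalSpace K] [CompactSpace K]
  {E F : Type u} [NormedAddCommGroup E] [NormedSpace ℝ E]
  [NormedAddCommGroup F] [NormedSpace ℝ F]

/-- Pointwise application of a continuous family of operators, as a bilinear map. -/
noncomputable def pointwiseApply (K : Type*) [TopologicalSpace K] [CompactSpace K]
    (E F : Type u) [NormedAddCommGroup E] [NormedSpace ℝ E]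
    [NormedAddCommGroup F] [NormedSpace ℝ F] :
    C(K, E →L[ℝ] F) →L[ℝ] C(K, E) →L[ℝ] C(K, F) :=
  LinearMap.mkContinuous₂
    (LinearMap.mk₂ ℝ (fun (A : C(K, E →L[ℝ] F)) (v : C(K, E)) =>
        (⟨fun k => A k (v k), by fun_prop⟩ : C(K, F)))
      (fun A B v => by ext k; simp) (fun c A v => by ext k; simp)
      (fun A v w => by ext k; simp) (fun c A v => by ext k; simp))
    1 (fun A v => by
      rw [one_mul]
      refine (ContinuousMap.norm_le _ (by positivity)).2 fun k => ?_
      exact ((A k).le_opNorm (v k)).trans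
        (mul_le_mul (A.norm_coe_le_norm k) (v.norm_coe_le_norm k) (norm_nonneg _) (norm_nonneg A)))

@[simp]
lemma pointwiseApply_apply (A : C(K, E →L[ℝ] F)) (v : C(K, E)) (k : K) :
    pointwiseApply K E F A v k = A k (v k) := rfl

/-- The range of u is compact, so `fderiv ℝ f` is uniformly continuous at it; the mean value
inequality then bounds the remainder uniformly in k. -/
lemma hasFDerivAt_postcomp {f : E → F} (hf : ContDiff ℝ 1 f) (u : C(K, E)) :
    HasFDerivAt (fun v : C(K, E) => (⟨f, hf.continuous⟩ : C(E, F)).comp v)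
      (pointwiseApply K E F
        ((⟨fderiv ℝ f, hf.continuous_fderiv one_ne_zero⟩ : C(E, E →L[ℝ] F)).comp u)) u := by
  rw [hasFDerivAt_iff_isLittleO_nhds_zero, Asymptotics.isLittleO_iff]
  intro c hc
  have hcomp : IsCompact (range u) := isCompact_range u.continuous
  have hU := hcomp.uniformContinuousAt_of_continuousAt (fderiv ℝ f)
    (fun a _ => (hf.continuous_fderiv one_ne_zero).continuousAt) (Metric.dist_mem_uniformity hc)
  obtain ⟨r, hr, hrU⟩ := Metric.mem_uniformity_dist.1 hU
  filter_upwards [Metric.ball_mem_nhds (0 : C(K, E)) hr] with v hv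
  rw [mem_ball_zero_iff] at hv
  refine (ContinuousMap.norm_le _ (by positivity)).2 fun k => ?_
  have hvk : ‖v k‖ < r := (v.norm_coe_le_norm k).trans_lt hv
  have key := (convex_ball (u k) r).norm_image_sub_le_of_norm_hasFDerivWithin_le'
    (f := f) (f' := fderiv ℝ f) (φ := fderiv ℝ f (u k)) (C := c) (x := u k) (y := u k + v k)
    (fun x _ => ((hf.differentiable one_ne_zero) x).hasFDerivAt.hasFDerivWithinAt)
    (fun x hx => by
      have h := @hrU (u k) x (by rw [dist_comm]; exact hx) (mem_range_self k)
      rw [← dist_eq_norm, dist_comm]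
      exact h.le)
    (Metric.mem_ball_self hr) (by simpa [Metric.mem_ball, dist_eq_norm] using hvk)
  have : ‖f (u k + v k) - f (u k) - fderiv ℝ f (u k) (v k)‖ ≤ c * ‖v k‖ := by
    simpa using key
  exact this.trans (mul_le_mul_of_nonneg_left (v.norm_coe_le_norm k) hc.le)

/-- The derivative is again a composition operator, with `fderiv ℝ f`, followed by the bounded map
`pointwiseApply`. The induction replaces the target F by E →L[ℝ] F, hence the quantifier over F and
the common universe. -/
lemma contDiff_postcomp (n : ℕ) : ∀ {F : Type u} [NormedAddCommGroup F] [NormedSpace ℝ F]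
    {f : E → F} (hf : ContDiff ℝ n f),
    ContDiff ℝ n (fun v : C(K, E) => (⟨f, hf.continuous⟩ : C(E, F)).comp v) := by
  induction n with
  | zero =>
    intro F _ _ f hf
    exact contDiff_zero.2 (ContinuousMap.continuous_postcomp _)
  | succ n ih =>
    intro F _ _ f hf
    have hf1 : ContDiff ℝ 1 f := hf.of_le (by exact_mod_cast Nat.le_add_left 1 n)
    have hf' : ContDiff ℝ n (fderiv ℝ f) := hf.fderiv_right (by norm_cast)
    have := contDiff_succ_iff_hasFDerivAt (𝕜 := ℝ) (n := n)
      (f := fun v : C(K, E) => (⟨f, hf.continuous⟩ : C(E, F)).comp v)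
    push_cast at this ⊢
    rw [this]
    exact ⟨fun u => pointwiseApply K E F ((⟨fderiv ℝ f, hf'.continuous⟩ : C(E, E →L[ℝ] F)).comp u),
      (ih hf').continuousLinearMap_comp (pointwiseApply K E F), fun u => hasFDerivAt_postcomp hf1 u⟩

end Nemytskii

/-! ### Volterra operators -/

section Volterra

lemma intervalIntegrable_IccExtend {E : Type*} [NormedAddCommGroup E] (v : C(unitInterval, E)) (a b : ℝ) :
    IntervalIntegrable (Set.IccExtend zero_le_one v) MeasureTheory.volume a b :=
  (v.continuous.Icc_extend' (h := zero_le_one)).intervalIntegrable a b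

variable {E : Type u} [NormedAddCommGroup E] [NormedSpace ℝ E]

/-- The primitive vanishing at `0`, as an operator on `C([0, 1], E)`. -/
noncomputable def primitive (E : Type u) [NormedAddCommGroup E] [NormedSpace ℝ E] :
    C(unitInterval, E) →L[ℝ] C(unitInterval, E) :=
  LinearMap.mkContinuous
    { toFun := fun v => ⟨fun t => ∫ s in (0 : ℝ)..t, Set.IccExtend zero_le_one v s,
        (intervalIntegral.continuous_primitive (fun a b => intervalIntegrable_IccExtend v a b)
          0).comp continuous_subtype_val⟩
      map_add' := fun v w => by
        ext t
        exact intervalIntegral.integral_add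
          (intervalIntegrable_IccExtend v 0 t) (intervalIntegrable_IccExtend w 0 t)
      map_smul' := fun c v => by
        ext t
        exact intervalIntegral.integral_smul (μ := MeasureTheory.volume)
          (a := 0) (b := (t : ℝ)) c (Set.IccExtend zero_le_one v) }
    1 (fun v => by
      rw [one_mul]
      refine (ContinuousMap.norm_le _ (by positivity)).2 fun t => ?_
      have := intervalIntegral.norm_integral_le_of_norm_le_const (a := 0) (b := (t : ℝ))
        (f := Set.IccExtend zero_le_one v) (C := ‖v‖) (fun s _ => v.norm_coe_le_norm _)
      refine this.trans ?_
      rw [sub_zero, abs_of_nonneg t.2.1]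
      exact mul_le_of_le_one_right (norm_nonneg _) t.2.2)

lemma primitive_apply (v : C(unitInterval, E)) (t : unitInterval) :
    primitive E v t = ∫ s in (0 : ℝ)..t, Set.IccExtend zero_le_one v s := rfl

lemma norm_volterra_pow_apply_le (A : C(unitInterval, E →L[ℝ] E)) (n : ℕ)
    (v : C(unitInterval, E)) (t : unitInterval) :
    ‖(((primitive E).comp (pointwiseApply unitInterval E E A)) ^ n) v t‖
      ≤ ‖A‖ ^ n * (t : ℝ) ^ n / n.factorial * ‖v‖ := by
  induction n generalizing t with
  | zero => simpa using v.norm_coe_le_norm t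
  | succ n ih =>
    set V := (primitive E).comp (pointwiseApply unitInterval E E A) with hV
    rw [pow_succ']
    change ‖∫ s in (0 : ℝ)..t, Set.IccExtend zero_le_one
      (pointwiseApply unitInterval E E A ((V ^ n) v)) s‖ ≤ _
    have hint : IntervalIntegrable
        (fun s : ℝ => ‖A‖ ^ (n + 1) / n.factorial * ‖v‖ * s ^ n) MeasureTheory.volume 0 t :=
      Continuous.intervalIntegrable (by fun_prop) _ _
    refine (intervalIntegral.norm_integral_le_of_norm_le t.2.1 ?_ hint).trans (le_of_eq ?_)
    · refine Filter.Eventually.of_forall fun s hs => ?_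
      have hs' : s ∈ Icc (0 : ℝ) 1 := ⟨hs.1.le, hs.2.trans t.2.2⟩
      rw [IccExtend_of_mem _ _ hs', pointwiseApply_apply]
      refine ((A _).le_opNorm _).trans ?_
      refine (mul_le_mul (A.norm_coe_le_norm _) (ih ⟨s, hs'⟩) (norm_nonneg _)
        (norm_nonneg A)).trans (le_of_eq ?_)
      simp only
      ring
    · rw [intervalIntegral.integral_const_mul, integral_pow, Nat.factorial_succ]
      push_cast
      have : (n.factorial : ℝ) ≠ 0 := by positivity
      field_simp
      simp

/-- The factorial bound makes some power V ^ n a contraction, however large A is. Then 1 - V ^ n is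
invertible and is a product of commuting factors, one of which is 1 - V. -/
lemma isUnit_one_sub_volterra (A : C(unitInterval, E →L[ℝ] E)) [CompleteSpace E] :
    IsUnit (1 - (primitive E).comp (pointwiseApply unitInterval E E A)) := by
  set V := (primitive E).comp (pointwiseApply unitInterval E E A) with hV
  obtain ⟨n, hn⟩ : ∃ n : ℕ, ‖A‖ ^ n / n.factorial < 1 :=
    ((FloorSemiring.tendsto_pow_div_factorial_atTop ‖A‖).eventually_lt_const one_pos).exists
  have hVn : ‖V ^ n‖ < 1 := by
    refine lt_of_le_of_lt (ContinuousLinearMap.opNorm_le_bound _ (by positivity) fun v => ?_) hn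
    refine (ContinuousMap.norm_le _ (by positivity)).2 fun t => ?_
    refine (norm_volterra_pow_apply_le A n v t).trans ?_
    gcongr
    exact mul_le_of_le_one_right (by positivity) (pow_le_one₀ t.2.1 t.2.2)
  have h1 : IsUnit (1 - V ^ n) := isUnit_one_sub_of_norm_lt_one (x := V ^ n) hVn
  have h2 : (1 - V) * (∑ i ∈ Finset.range n, V ^ i) = 1 - V ^ n := mul_neg_geom_sum V n
  rw [← h2] at h1
  refine ((Commute.isUnit_mul_iff ?_).1 h1).1
  exact (Commute.one_left _).sub_left (Commute.sum_right _ _ _ fun i _ => Commute.self_pow V i)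

end Volterra

/-! ### Smooth dependence of solutions on initial conditions -/

section FlowSmooth

variable {E F : Type u} [NormedAddCommGroup E] [NormedSpace ℝ E]
  [NormedAddCommGroup F] [NormedSpace ℝ F]

/-- Multiply f by a cutoff equal to 1 near K and vanishing outside a compact subset of U. -/
lemma ContDiffOn.exists_contDiff_eq_near_compact [FiniteDimensional ℝ E] {n : ℕ} {f : E → F}
    {U K : Set E} (hf : ContDiffOn ℝ n f U) (hU : IsOpen U) (hK : IsCompact K) (hKU : K ⊆ U) :
    ∃ (g : E → F) (W : Set E), ContDiff ℝ n g ∧ IsOpen W ∧ K ⊆ W ∧ W ⊆ U ∧ EqOn g f W := by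
  obtain ⟨t, ht, hKt, htU⟩ := exists_compact_between hK hU hKU
  obtain ⟨χ, hχ1, hχ0, -⟩ := exists_contMDiffMap_one_nhds_of_subset_interior
    (modelWithCornersSelf ℝ E) (n := (n : ℕ∞)) hK.isClosed hKt
  have hχ : ContDiff ℝ n χ := χ.contMDiff.contDiff
  obtain ⟨V, hV, hKV, hV1⟩ := eventually_nhdsSet_iff_exists.1 hχ1
  refine ⟨fun x => χ x • f x, V ∩ U, contDiff_iff_contDiffAt.2 fun x => ?_, hV.inter hU,
    subset_inter hKV hKU, inter_subset_right, fun x hx => by simp [hV1 x hx.1]⟩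
  by_cases hx : x ∈ U
  · exact hχ.contDiffAt.smul (hf.contDiffAt (hU.mem_nhds hx))
  · refine (contDiffAt_const (c := (0 : F))).congr_of_eventuallyEq ?_
    filter_upwards [ht.isClosed.isOpen_compl.mem_nhds fun h => hx (htU h)] with y hy
    simp [hχ0 y hy]

/-- The embedding of `E` into `C([0, 1], E)` by constant functions. -/
noncomputable def constCurve (E : Type u) [NormedAddCommGroup E] [NormedSpace ℝ E] :
    E →L[ℝ] C(unitInterval, E) :=
  LinearMap.mkContinuous
    { toFun := fun x => ContinuousMap.const _ x
      map_add' := fun x y => by ext; simp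
      map_smul' := fun c x => by ext; simp }
    1 (fun x => by
      rw [one_mul]
      exact (ContinuousMap.norm_le _ (norm_nonneg _)).2 fun t => le_rfl)

/-- A solution of a `C^n` autonomous equation on `[0, 1]` belongs to a family of solutions, whose
time-one map is `C^n` near the given solution. -/
theorem exists_family_of_solutions [FiniteDimensional ℝ E] {n : ℕ} (hn : n ≠ 0) {f : E → E}
    {U : Set E} (hU : IsOpen U) (hf : ContDiffOn ℝ n f U) {u : ℝ → E}
    (hu : ∀ t ∈ Icc (0 : ℝ) 1, HasDerivWithinAt u (f (u t)) (Icc 0 1) t)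
    (huU : ∀ t ∈ Icc (0 : ℝ) 1, u t ∈ U) :
    ∃ φ : E → ℝ → E, ContDiffAt ℝ n (fun x => φ x 1) (u 0) ∧
      ∀ᶠ x in 𝓝 (u 0), φ x 0 = x ∧ ∀ t ∈ Icc (0 : ℝ) 1, φ x t ∈ U ∧
        HasDerivWithinAt (φ x) (f (φ x t)) (Icc 0 1) t := by
  have : CompleteSpace E := FiniteDimensional.complete ℝ E
  have hucont : ContinuousOn u (Icc 0 1) := fun t ht => (hu t ht).continuousWithinAt
  -- A globally smooth g makes the composition operator available on all of C([0, 1], E); curves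
  -- staying in W do not see the change.
  obtain ⟨g, W, hg, hW, huW, hWU, hgf⟩ := hf.exists_contDiff_eq_near_compact hU
    (isCompact_Icc.image_of_continuousOn hucont) (image_subset_iff.2 huU)
  set g' : C(E, E) := ⟨g, hg.continuous⟩ with hg'
  set u' : C(unitInterval, E) := ⟨fun t => u t, hucont.domRestrict⟩ with hu'
  -- The equation N v = const x is the integral form of v' = g(v), v(0) = x. The derivative of N is
  -- the identity minus a Volterra operator.
  set N : C(unitInterval, E) → C(unitInterval, E) := fun v => v - primitive E (g'.comp v) with hN
  have hn' : (n : WithTop ℕ∞) ≠ 0 := by exact_mod_cast hn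
  have hg1 : ContDiff ℝ 1 g := hg.of_le (by exact_mod_cast Nat.one_le_iff_ne_zero.2 hn)
  have hNsmooth : ContDiff ℝ n N :=
    contDiff_id.sub ((contDiff_postcomp n hg).continuousLinearMap_comp (primitive E))
  obtain ⟨V, hV⟩ := isUnit_one_sub_volterra
    ((⟨fderiv ℝ g, hg1.continuous_fderiv one_ne_zero⟩ : C(E, E →L[ℝ] E)).comp u')
  have hNd : HasFDerivAt N ((ContinuousLinearEquiv.ofUnit V : C(unitInterval, E) ≃L[ℝ] _) :
      C(unitInterval, E) →L[ℝ] C(unitInterval, E)) u' := by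
    have h1 := (hasFDerivAt_id u').sub
      ((primitive E).hasFDerivAt.comp u' (hasFDerivAt_postcomp hg1 u'))
    exact h1.congr_fderiv hV.symm
  have hstrict := hNsmooth.contDiffAt.hasStrictFDerivAt' hNd hn'
  -- the fixed point equation determines the solutions
  have hprim : ∀ v : C(unitInterval, E), ∀ t, HasDerivAt
      (fun t => ∫ s in (0 : ℝ)..t, Set.IccExtend zero_le_one (g'.comp v) s)
      (Set.IccExtend zero_le_one (g'.comp v) t) t := fun v t =>
    ((g'.comp v).continuous.Icc_extend' (h := zero_le_one)).integral_hasStrictDerivAt 0 t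
      |>.hasDerivAt
  have hNu : N u' = constCurve E (u 0) := by
    ext t
    have hint : ∫ s in (0 : ℝ)..t, Set.IccExtend zero_le_one (g'.comp u') s = u t - u 0 := by
      refine intervalIntegral.integral_eq_sub_of_hasDeriv_right_of_le t.2.1
        (hucont.mono (Icc_subset_Icc_right t.2.2)) (fun s hs => ?_)
        (intervalIntegrable_IccExtend _ _ _)
      have hs' : s ∈ Icc (0 : ℝ) 1 := ⟨hs.1.le, hs.2.le.trans t.2.2⟩
      rw [IccExtend_of_mem _ _ hs']
      change HasDerivWithinAt u (g (u s)) _ _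
      rw [hgf (huW (mem_image_of_mem u hs'))]
      exact ((hu s hs').hasDerivAt (Icc_mem_nhds hs.1 (hs.2.trans_le t.2.2))).hasDerivWithinAt
    change u t - primitive E (g'.comp u') t = u 0
    rw [primitive_apply, hint]
    abel
  set Ψ := hstrict.localInverse N _ u' with hΨ
  have hΨu : Ψ (constCurve E (u 0)) = u' := by
    rw [← hNu]; exact hstrict.localInverse_apply_image
  have hΨsmooth : ContDiffAt ℝ n Ψ (constCurve E (u 0)) := by
    rw [← hNu]; exact hNsmooth.contDiffAt.to_localInverse hNd hn'
  have hΦsmooth : ContDiffAt ℝ n (fun x => Ψ (constCurve E x)) (u 0) :=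
    hΨsmooth.comp (u 0) (constCurve E).contDiff.contDiffAt
  refine ⟨fun x => Set.IccExtend zero_le_one (Ψ (constCurve E x)), ?_, ?_⟩
  · have : (fun x => Set.IccExtend zero_le_one (Ψ (constCurve E x)) (1 : ℝ))
        = fun x => ContinuousMap.evalCLM ℝ (1 : unitInterval) (Ψ (constCurve E x)) := by
      ext x
      simp only [Set.IccExtend, Function.comp]
      simp
    rw [this]
    exact hΦsmooth.continuousLinearMap_comp _
  · have hev : ∀ᶠ x in 𝓝 (u 0), N (Ψ (constCurve E x)) = constCurve E x := by
      have := hstrict.eventually_right_inverse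
      rw [hNu] at this
      exact (constCurve E).continuous.continuousAt.eventually this
    have hev2 : ∀ᶠ x in 𝓝 (u 0), MapsTo (Ψ (constCurve E x)) univ W := by
      refine hΦsmooth.continuousAt.eventually
        ((ContinuousMap.isOpen_setOfPred_mapsTo isCompact_univ hW).mem_nhds ?_)
      change MapsTo (Ψ (constCurve E (u 0))) univ W
      rw [hΨu]
      exact fun t _ => huW (mem_image_of_mem u t.2)
    filter_upwards [hev, hev2] with x hx hxW
    set v := Ψ (constCurve E x) with hv
    have hvt : ∀ t ∈ Icc (0 : ℝ) 1, Set.IccExtend zero_le_one v t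
        = x + ∫ s in (0 : ℝ)..t, Set.IccExtend zero_le_one (g'.comp v) s := by
      intro t ht
      have := DFunLike.congr_fun hx ⟨t, ht⟩
      change v ⟨t, ht⟩ - primitive E (g'.comp v) ⟨t, ht⟩ = x at this
      rw [primitive_apply] at this
      rw [IccExtend_of_mem _ _ ht, ← this]
      abel
    refine ⟨by simpa using hvt 0 (by simp), fun t ht => ?_⟩
    have htW : Set.IccExtend zero_le_one v t ∈ W := by
      rw [IccExtend_of_mem _ _ ht]; exact hxW (mem_univ _)
    refine ⟨hWU htW, ?_⟩
    have h1 := ((hprim v t).const_add x).hasDerivWithinAt (s := Icc 0 1)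
    rw [IccExtend_of_mem _ _ ht] at h1
    rw [← hgf htW]
    have h2 := h1.congr hvt (hvt t ht)
    convert h2 using 1
    rw [IccExtend_of_mem _ _ ht]; rfl

/-- Uniqueness of the solutions of an equation with locally Lipschitz right-hand side. -/
theorem eqOn_of_hasDerivWithinAt_Icc {f : E → E} {U : Set E} (hU : IsOpen U)
    (hf : ContDiffOn ℝ 1 f U) {a b : ℝ} {u v : ℝ → E}
    (hu : ∀ t ∈ Icc a b, u t ∈ U ∧ HasDerivWithinAt u (f (u t)) (Icc a b) t)
    (hv : ∀ t ∈ Icc a b, v t ∈ U ∧ HasDerivWithinAt v (f (v t)) (Icc a b) t)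
    (h : u a = v a) : EqOn u v (Icc a b) := by
  have hcu : ContinuousOn u (Icc a b) := fun t ht => (hu t ht).2.continuousWithinAt
  have hcv : ContinuousOn v (Icc a b) := fun t ht => (hv t ht).2.continuousWithinAt
  have hK : IsCompact (u '' Icc a b ∪ v '' Icc a b) :=
    (isCompact_Icc.image_of_continuousOn hcu).union (isCompact_Icc.image_of_continuousOn hcv)
  have hKU : u '' Icc a b ∪ v '' Icc a b ⊆ U :=
    union_subset (image_subset_iff.2 fun t ht => (hu t ht).1)
      (image_subset_iff.2 fun t ht => (hv t ht).1)
  obtain ⟨L, hL⟩ := LocallyLipschitzOn.exists_lipschitzOnWith_of_compact hK (f := f)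
    (fun x hx => by
      obtain ⟨L, t, ht, hL⟩ :=
        (hf.contDiffAt (hU.mem_nhds (hKU hx))).exists_lipschitzOnWith
      exact ⟨L, t, mem_nhdsWithin_of_mem_nhds ht, hL⟩)
  have hder : ∀ w : ℝ → E, (∀ t ∈ Icc a b, w t ∈ U ∧ HasDerivWithinAt w (f (w t)) (Icc a b) t) →
      ∀ t ∈ Ico a b, HasDerivWithinAt w (f (w t)) (Ici t) t := fun w hw t ht =>
    (hw t (Ico_subset_Icc_self ht)).2.mono_of_mem_nhdsWithin (Icc_mem_nhdsGE_of_mem ht)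
  exact ODE_solution_unique_of_mem_Icc_right (v := fun _ => f) (s := fun _ => _)
    (fun _ _ => hL) hcu (hder u hu) (fun t ht => Or.inl (mem_image_of_mem u (Ico_subset_Icc_self ht)))
    hcv (hder v hv) (fun t ht => Or.inr (mem_image_of_mem v (Ico_subset_Icc_self ht))) h

end FlowSmooth

/-- Uniqueness on the whole line of the solutions of an autonomous equation. -/
theorem eq_of_hasDerivAt_of_eq {E : Type*} [NormedAddCommGroup E] [NormedSpace ℝ E] {f : E → E}
    {U : Set E} (hU : IsOpen U) (hf : ContDiffOn ℝ 1 f U) {u v : ℝ → E}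
    (hu : ∀ t, u t ∈ U ∧ HasDerivAt u (f (u t)) t) (hv : ∀ t, v t ∈ U ∧ HasDerivAt v (f (v t)) t)
    {t₀ : ℝ} (h : u t₀ = v t₀) : u = v := by
  ext t
  rcases le_total t₀ t with ht | ht
  · exact eqOn_of_hasDerivWithinAt_Icc hU hf (a := t₀) (b := t)
      (fun s _ => ⟨(hu s).1, (hu s).2.hasDerivWithinAt⟩)
      (fun s _ => ⟨(hv s).1, (hv s).2.hasDerivWithinAt⟩) h ⟨ht, le_rfl⟩
  -- Backward uniqueness is forward uniqueness for the reversed field -f.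
  · have hneg : ∀ w : ℝ → E, (∀ t, w t ∈ U ∧ HasDerivAt w (f (w t)) t) →
        ∀ s ∈ Icc (-t₀) (-t), w (-s) ∈ U ∧
          HasDerivWithinAt (fun s => w (-s)) ((-f) (w (-s))) (Icc (-t₀) (-t)) s := fun w hw s _ => by
      refine ⟨(hw _).1, ?_⟩
      have := (hw (-s)).2.scomp s (hasDerivAt_neg s)
      simpa [Function.comp_def] using this.hasDerivWithinAt
    simpa using eqOn_of_hasDerivWithinAt_Icc hU hf.neg (a := -t₀) (b := -t)
      (hneg u hu) (hneg v hv) (by simpa using h) (show -t ∈ Icc (-t₀) (-t) from ⟨by linarith, le_rfl⟩)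

namespace PeriodicIntegrableSystem

variable {k : ℕ} (S : PeriodicIntegrableSystem k)

/-! ### The unperturbed flow -/

/-- Time is turned into an initial condition: the first component of the time-one map of x' = s
f₀(x), s' = 0 is `flow s x`. Uniqueness identifies the smooth family with the given flow. -/
lemma contDiffAt_flow {x : Phase k} (hx : x ∈ S.D) (s : ℝ) :
    ContDiffAt ℝ 2 (fun p : Phase k × ℝ => S.flow p.2 p.1) (x, s) := by
  set f : Phase k × ℝ → Phase k × ℝ := fun p => (p.2 • S.f₀ p.1, 0) with hf
  have hU : IsOpen (S.D ×ˢ (univ : Set ℝ)) := S.isOpen_D.prod isOpen_univ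
  have hfs : ContDiffOn ℝ 2 f (S.D ×ˢ (univ : Set ℝ)) :=
    (contDiff_snd.contDiffOn.smul
      (S.contDiffOn_f₀.comp contDiff_fst.contDiffOn fun p hp => hp.1)).prodMk contDiffOn_const
  have hsol : ∀ p ∈ S.D ×ˢ (univ : Set ℝ), ∀ t ∈ Icc (0 : ℝ) 1,
      ((S.flow (p.2 * t) p.1, p.2) : Phase k × ℝ) ∈ S.D ×ˢ (univ : Set ℝ) ∧
      HasDerivWithinAt (fun t => ((S.flow (p.2 * t) p.1, p.2) : Phase k × ℝ))
        (f (S.flow (p.2 * t) p.1, p.2)) (Icc 0 1) t := fun p hp t _ => by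
    refine ⟨⟨S.flow_mem _ hp.1 _, mem_univ _⟩, HasDerivAt.hasDerivWithinAt ?_⟩
    have h1 := (S.hasDerivAt_flow p.1 hp.1 (p.2 * t)).scomp t ((hasDerivAt_id t).const_mul p.2)
    simpa [hf] using h1.prodMk (hasDerivAt_const t p.2)
  have h0 : ((S.flow (s * 0) x, s) : Phase k × ℝ) = (x, s) := by
    rw [mul_zero, S.flow_zero x hx]
  obtain ⟨φ, hφs, hφ⟩ := exists_family_of_solutions (n := 2) two_ne_zero hU hfs
    (u := fun t => (S.flow (s * t) x, s)) (fun t ht => (hsol (x, s) ⟨hx, mem_univ _⟩ t ht).2)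
    (fun t ht => (hsol (x, s) ⟨hx, mem_univ _⟩ t ht).1)
  simp only [h0] at hφs hφ
  refine (contDiff_fst.contDiffAt.comp _ hφs).congr_of_eventuallyEq ?_
  filter_upwards [hφ, hU.mem_nhds ⟨hx, mem_univ s⟩] with p hp hpU
  have := eqOn_of_hasDerivWithinAt_Icc hU (hfs.of_le one_le_two) (hsol p hpU) hp.2
    (by simp [hp.1, S.flow_zero _ hpU.1]) (right_mem_Icc.2 zero_le_one)
  simp only [mul_one] at this
  simp only [Function.comp, ← this]

lemma flow_eq_of_solution {x : Phase k} (hx : x ∈ S.D) {u : ℝ → Phase k}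
    (hu : ∀ t, u t ∈ S.D ∧ HasDerivAt u (S.f₀ (u t)) t) {t₀ : ℝ} (h : u t₀ = S.flow t₀ x) (t : ℝ) :
    u t = S.flow t x :=
  congrFun (eq_of_hasDerivAt_of_eq S.isOpen_D (S.contDiffOn_f₀.of_le one_le_two) hu
    (fun t => ⟨S.flow_mem x hx t, S.hasDerivAt_flow x hx t⟩) h) t

lemma P_pos {x : Phase k} (hx : x ∈ S.D) : 0 < S.P x := (S.isLeast_P x hx).1.1

lemma flow_P {x : Phase k} (hx : x ∈ S.D) : S.flow (S.P x) x = x := (S.isLeast_P x hx).1.2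

lemma flow_add_P {x : Phase k} (hx : x ∈ S.D) (t : ℝ) : S.flow (t + S.P x) x = S.flow t x := by
  refine S.flow_eq_of_solution hx (u := fun t => S.flow (t + S.P x) x) (t₀ := 0)
    (fun t => ⟨S.flow_mem x hx _, (S.hasDerivAt_flow x hx _).comp_add_const t (S.P x)⟩) ?_ t
  simp [S.flow_P hx, S.flow_zero x hx]

lemma flow_add_nat_mul_P {x : Phase k} (hx : x ∈ S.D) (t : ℝ) (m : ℕ) :
    S.flow (t + m * S.P x) x = S.flow t x := by
  have : Function.Periodic (fun t => S.flow t x) (S.P x) := S.flow_add_P hx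
  exact this.nat_mul m t

/-- At an equilibrium half of the least period would be a period as well. -/
lemma f₀_ne_zero {x : Phase k} (hx : x ∈ S.D) : S.f₀ x ≠ 0 := by
  intro h
  have hc : ∀ t, x = S.flow t x := S.flow_eq_of_solution hx (u := fun _ => x) (t₀ := 0)
    (fun t => ⟨hx, by simpa [h] using hasDerivAt_const t x⟩) (S.flow_zero x hx).symm
  have := (S.isLeast_P x hx).2 ⟨half_pos (S.P_pos hx), (hc _).symm⟩
  linarith [S.P_pos hx]

lemma contDiffAt_I {x : Phase k} (hx : x ∈ S.D) : ContDiffAt ℝ 2 S.I x :=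
  S.contDiffOn_I.contDiffAt (S.isOpen_D.mem_nhds hx)

lemma hasFDerivAt_I {x : Phase k} (hx : x ∈ S.D) : HasFDerivAt S.I (fderiv ℝ S.I x) x :=
  ((S.contDiffAt_I hx).differentiableAt two_ne_zero).hasFDerivAt

lemma fderiv_I_f₀ {x : Phase k} (hx : x ∈ S.D) : fderiv ℝ S.I x (S.f₀ x) = 0 := by
  have h1 := S.hasDerivAt_flow x hx 0
  have h2 := S.hasFDerivAt_I hx
  rw [← S.flow_zero x hx] at h2
  have h3 := h2.comp_hasDerivAt (0 : ℝ) h1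
  rw [S.flow_zero x hx] at h3
  exact h3.unique ((hasDerivAt_const (0 : ℝ) (S.I x)).congr_of_eventuallyEq
    (Eventually.of_forall fun t => S.I_flow x hx t))

/-- The kernel of `DI` is spanned by the vector field. -/
lemma exists_eq_smul_f₀ {x : Phase k} (hx : x ∈ S.D) {v : Phase k} (hv : fderiv ℝ S.I x v = 0) :
    ∃ c : ℝ, v = c • S.f₀ x := by
  have hr := LinearMap.finrank_range_add_finrank_ker (fderiv ℝ S.I x).toLinearMap
  have hrange : (fderiv ℝ S.I x).toLinearMap.range = ⊤ :=
    LinearMap.range_eq_top.2 (S.submersion_I x hx)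
  rw [hrange, finrank_top] at hr
  simp only [Module.finrank_fin_fun, finrank_euclideanSpace, Fintype.card_fin] at hr
  have h1 : Module.finrank ℝ (fderiv ℝ S.I x).toLinearMap.ker = 1 := by omega
  obtain ⟨c, hc⟩ := (finrank_eq_one_iff_of_nonzero'
    (⟨S.f₀ x, S.fderiv_I_f₀ hx⟩ : (fderiv ℝ S.I x).toLinearMap.ker)
    (fun h => S.f₀_ne_zero hx (congrArg Subtype.val h))).1 h1 ⟨v, hv⟩
  exact ⟨c, (congrArg Subtype.val hc).symm⟩

lemma eq_smul_f₀ {x : Phase k} (hx : x ∈ S.D) {v : Phase k} (hv : fderiv ℝ S.I x v = 0) :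
    v = (inner ℝ (S.f₀ x) v / ‖S.f₀ x‖ ^ 2) • S.f₀ x := by
  obtain ⟨c, rfl⟩ := S.exists_eq_smul_f₀ hx hv
  have : ‖S.f₀ x‖ ≠ 0 := norm_ne_zero_iff.2 (S.f₀_ne_zero hx)
  rw [inner_smul_right, real_inner_self_eq_norm_sq]
  congr 1
  field_simp

/-! ### The section as a function of the integrals -/

lemma exists_mem_D₀ {ξ : Fin k → ℝ} (hξ : ξ ∈ S.Lam) : ∃ p ∈ S.D₀, S.I p = ξ := by
  obtain ⟨x, hx, rfl⟩ := hξ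
  obtain ⟨p, ⟨hp, t, rfl⟩, -⟩ := S.orbit_inter_D₀ x hx
  exact ⟨_, hp, S.I_flow x hx t⟩

lemma x₀_mem_D₀ {ξ : Fin k → ℝ} (hξ : ξ ∈ S.Lam) : S.x₀ ξ ∈ S.D₀ :=
  Function.invFunOn_mem (S.exists_mem_D₀ hξ)

lemma x₀_mem {ξ : Fin k → ℝ} (hξ : ξ ∈ S.Lam) : S.x₀ ξ ∈ S.D := S.D₀_subset (S.x₀_mem_D₀ hξ)

lemma I_x₀ {ξ : Fin k → ℝ} (hξ : ξ ∈ S.Lam) : S.I (S.x₀ ξ) = ξ :=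
  Function.invFunOn_eq (S.exists_mem_D₀ hξ)

/-- With g a local equation of the section, (I, g) is a local diffeomorphism: the kernel of DI is
spanned by f₀, on which Dg is non-zero by transversality. Its inverse restricted to g = 0 takes
values in the section, hence agrees with `x₀` by injectivity of I there. -/
lemma Lam_mem_nhds_and_contDiffAt_x₀ {ξ : Fin k → ℝ} (hξ : ξ ∈ S.Lam) :
    S.Lam ∈ 𝓝 ξ ∧ ContDiffAt ℝ 2 S.x₀ ξ := by
  set p := S.x₀ ξ with hp
  have hpD : p ∈ S.D := S.x₀_mem hξ
  obtain ⟨U, g, hU, hpU, hg, hSU, hgf⟩ := S.transverse_D₀ p (S.x₀_mem_D₀ hξ)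
  have hgp : g p = 0 := by
    have : p ∈ S.D₀ ∩ U := ⟨S.x₀_mem_D₀ hξ, hpU⟩
    rw [hSU] at this
    exact this.2
  set H : Phase k → (Fin k → ℝ) × ℝ := fun x => (S.I x, g x) with hH
  have hgs : ContDiffAt ℝ 2 g p := hg.contDiffAt (hU.mem_nhds hpU)
  have hHs : ContDiffAt ℝ 2 H p := (S.contDiffAt_I hpD).prodMk hgs
  have hHd : HasFDerivAt H ((fderiv ℝ S.I p).prod (fderiv ℝ g p)) p :=
    (S.hasFDerivAt_I hpD).prodMk (hgs.differentiableAt two_ne_zero).hasFDerivAt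
  have hinj : Function.Injective ((fderiv ℝ S.I p).prod (fderiv ℝ g p)).toLinearMap := by
    rw [injective_iff_map_eq_zero]
    intro v hv
    have hv' : (fderiv ℝ S.I p v, fderiv ℝ g p v) = 0 := hv
    obtain ⟨h1, h2⟩ := Prod.ext_iff.1 hv'
    obtain ⟨c, rfl⟩ := S.exists_eq_smul_f₀ hpD h1
    simp only [map_smul, smul_eq_mul, Prod.snd_zero, mul_eq_zero, hgf, or_false] at h2
    rw [h2, zero_smul]
  let e : Phase k ≃L[ℝ] (Fin k → ℝ) × ℝ :=
    (LinearEquiv.ofInjectiveOfFinrankEq _ hinj (by simp)).toContinuousLinearEquiv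
  have hHd' : HasFDerivAt H (e : Phase k →L[ℝ] (Fin k → ℝ) × ℝ) p := hHd
  have hstrict := hHs.hasStrictFDerivAt' hHd' two_ne_zero
  have hHp : H p = (ξ, 0) := Prod.ext (S.I_x₀ hξ) hgp
  set Ψ := hstrict.localInverse H e p with hΨ
  have hΨs : ContDiffAt ℝ 2 Ψ (ξ, 0) := by
    rw [← hHp]; exact hHs.to_localInverse hHd' two_ne_zero
  have hΨp : Ψ (ξ, 0) = p := by rw [← hHp]; exact hstrict.localInverse_apply_image
  have hi : ContDiffAt ℝ 2 (fun ξ' : Fin k → ℝ => (ξ', (0 : ℝ))) ξ :=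
    contDiffAt_id.prodMk contDiffAt_const
  have hs : ContDiffAt ℝ 2 (fun ξ' => Ψ (ξ', 0)) ξ := ContDiffAt.comp ξ hΨs hi
  have hright : ∀ᶠ ξ' in 𝓝 ξ, H (Ψ (ξ', 0)) = (ξ', 0) := by
    have := hstrict.eventually_right_inverse
    rw [hHp] at this
    exact hi.continuousAt.eventually this
  have hmem : ∀ᶠ ξ' in 𝓝 ξ, Ψ (ξ', 0) ∈ U ∩ S.D := by
    refine hs.continuousAt.eventually ((hU.inter S.isOpen_D).mem_nhds ?_)
    simpa only [hΨp] using ⟨hpU, hpD⟩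
  refine ⟨?_, hs.congr_of_eventuallyEq ?_⟩
  · filter_upwards [hright, hmem] with ξ' h1 h2
    exact ⟨_, h2.2, (Prod.ext_iff.1 h1).1⟩
  · filter_upwards [hright, hmem] with ξ' h1 h2
    have h3 : Ψ (ξ', 0) ∈ S.D₀ ∩ U := by
      rw [hSU]
      exact ⟨h2.1, (Prod.ext_iff.1 h1).2⟩
    have h4 : S.I (Ψ (ξ', 0)) = ξ' := (Prod.ext_iff.1 h1).1
    have hξ' : ξ' ∈ S.Lam := ⟨_, h2.2, h4⟩
    exact S.injOn_I (S.x₀_mem_D₀ hξ') h3.1 ((S.I_x₀ hξ').trans h4.symm)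

lemma isOpen_Lam : IsOpen S.Lam :=
  isOpen_iff_mem_nhds.2 fun _ hξ => (S.Lam_mem_nhds_and_contDiffAt_x₀ hξ).1

lemma period_pos {ξ : Fin k → ℝ} (hξ : ξ ∈ S.Lam) : 0 < S.period ξ := S.P_pos (S.x₀_mem hξ)

lemma contDiffAt_period {ξ : Fin k → ℝ} (hξ : ξ ∈ S.Lam) : ContDiffAt ℝ 1 S.period ξ :=
  (S.contDiffOn_P.contDiffAt (S.isOpen_D.mem_nhds (S.x₀_mem hξ))).comp ξ
    ((S.Lam_mem_nhds_and_contDiffAt_x₀ hξ).2.of_le one_le_two)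

lemma contDiffAt_Omega (T : ℝ) {ξ : Fin k → ℝ} (hξ : ξ ∈ S.Lam) :
    ContDiffAt ℝ 1 (S.Omega T) ξ :=
  contDiffAt_const.div (S.contDiffAt_period hξ) (S.period_pos hξ).ne'

/-! ### Coordinates: the integrals and the time along the unperturbed orbit -/

/-- The point reached at time `z.2` from the point of the section with integrals `z.1`. -/
noncomputable def timeChart (z : (Fin k → ℝ) × ℝ) : Phase k := S.flow z.2 (S.x₀ z.1)

lemma timeChart_mem {z : (Fin k → ℝ) × ℝ} (hz : z.1 ∈ S.Lam) : S.timeChart z ∈ S.D :=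
  S.flow_mem _ (S.x₀_mem hz) _

lemma I_timeChart {z : (Fin k → ℝ) × ℝ} (hz : z.1 ∈ S.Lam) : S.I (S.timeChart z) = z.1 :=
  (S.I_flow _ (S.x₀_mem hz) _).trans (S.I_x₀ hz)

lemma contDiffAt_timeChart {z : (Fin k → ℝ) × ℝ} (hz : z.1 ∈ S.Lam) :
    ContDiffAt ℝ 2 S.timeChart z :=
  ContDiffAt.comp z (g := fun p : Phase k × ℝ => S.flow p.2 p.1)
    (f := fun z : (Fin k → ℝ) × ℝ => (S.x₀ z.1, z.2)) (S.contDiffAt_flow (S.x₀_mem hz) z.2)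
    ((ContDiffAt.comp z (S.Lam_mem_nhds_and_contDiffAt_x₀ hz).2 contDiffAt_fst).prodMk
      contDiffAt_snd)

lemma hasFDerivAt_timeChart {z : (Fin k → ℝ) × ℝ} (hz : z.1 ∈ S.Lam) :
    HasFDerivAt S.timeChart (fderiv ℝ S.timeChart z) z :=
  ((S.contDiffAt_timeChart hz).differentiableAt two_ne_zero).hasFDerivAt

lemma fderiv_timeChart_time {z : (Fin k → ℝ) × ℝ} (hz : z.1 ∈ S.Lam) :
    fderiv ℝ S.timeChart z (0, 1) = S.f₀ (S.timeChart z) := by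
  have h1 : HasDerivAt (fun s : ℝ => (z.1, s)) (0, 1) z.2 :=
    (hasDerivAt_const _ _).prodMk (hasDerivAt_id _)
  have h2 : HasDerivAt (fun s => S.timeChart (z.1, s)) (fderiv ℝ S.timeChart z (0, 1)) z.2 :=
    HasFDerivAt.comp_hasDerivAt (f := fun s : ℝ => (z.1, s)) z.2 (S.hasFDerivAt_timeChart hz) h1
  exact h2.unique (S.hasDerivAt_flow _ (S.x₀_mem hz) z.2)

lemma fderiv_I_fderiv_timeChart {z : (Fin k → ℝ) × ℝ} (hz : z.1 ∈ S.Lam) (w : (Fin k → ℝ) × ℝ) :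
    fderiv ℝ S.I (S.timeChart z) (fderiv ℝ S.timeChart z w) = w.1 := by
  have h1 := (S.hasFDerivAt_I (S.timeChart_mem hz)).comp z (S.hasFDerivAt_timeChart hz)
  have h2 : HasFDerivAt (S.I ∘ S.timeChart) (ContinuousLinearMap.fst ℝ (Fin k → ℝ) ℝ) z := by
    refine hasFDerivAt_fst.congr_of_eventuallyEq ?_
    filter_upwards [continuous_fst.continuousAt.eventually (S.isOpen_Lam.mem_nhds hz)] with y hy
    exact S.I_timeChart hy
  exact DFunLike.congr_fun (h1.unique h2) w

lemma timeChart_add_period {z : (Fin k → ℝ) × ℝ} (hz : z.1 ∈ S.Lam) (m : ℕ) :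
    S.timeChart (z.1, z.2 + m * S.period z.1) = S.timeChart z :=
  S.flow_add_nat_mul_P (S.x₀_mem hz) _ _

/-- The perturbation in the coordinates given by `timeChart`. -/
noncomputable def drift (f₁ : Phase k → ℝ → ℝ → Phase k) (z : (Fin k → ℝ) × ℝ) (t ε : ℝ) :
    (Fin k → ℝ) × ℝ :=
  (fderiv ℝ S.I (S.timeChart z) (f₁ (S.timeChart z) t ε),
    inner ℝ (S.f₀ (S.timeChart z)) (f₁ (S.timeChart z) t ε - fderiv ℝ S.timeChart z
      (fderiv ℝ S.I (S.timeChart z) (f₁ (S.timeChart z) t ε), 0)) / ‖S.f₀ (S.timeChart z)‖ ^ 2)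

/-- After subtraction of the part with the prescribed DI-component, the remainder lies in ker DI,
hence is a multiple of f₀, the image of (0, 1); the inner product computes the multiple. -/
lemma fderiv_timeChart_drift (f₁ : Phase k → ℝ → ℝ → Phase k) {z : (Fin k → ℝ) × ℝ}
    (hz : z.1 ∈ S.Lam) (t ε : ℝ) :
    fderiv ℝ S.timeChart z (S.drift f₁ z t ε) = f₁ (S.timeChart z) t ε := by
  set v := f₁ (S.timeChart z) t ε
  set a := fderiv ℝ S.I (S.timeChart z) v
  have h1 : fderiv ℝ S.I (S.timeChart z) (v - fderiv ℝ S.timeChart z (a, 0)) = 0 := by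
    rw [map_sub, S.fderiv_I_fderiv_timeChart hz, sub_self]
  have h2 := S.eq_smul_f₀ (S.timeChart_mem hz) h1
  set c := inner ℝ (S.f₀ (S.timeChart z)) (v - fderiv ℝ S.timeChart z (a, 0)) /
    ‖S.f₀ (S.timeChart z)‖ ^ 2
  have h3 : S.drift f₁ z t ε = (a, 0) + c • ((0, 1) : (Fin k → ℝ) × ℝ) := by
    simp [drift, a, v, c]
  rw [h3, map_add, map_smul, S.fderiv_timeChart_time hz, ← h2]
  abel

lemma contDiffAt_drift {f₁ : Phase k → ℝ → ℝ → Phase k} {q : ((Fin k → ℝ) × ℝ) × ℝ × ℝ}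
    (hf₁ : ContDiffAt ℝ 1 (fun p : Phase k × ℝ × ℝ => f₁ p.1 p.2.1 p.2.2)
      (S.timeChart q.1, q.2.1, q.2.2)) (hq : q.1.1 ∈ S.Lam) :
    ContDiffAt ℝ 1 (fun q : ((Fin k → ℝ) × ℝ) × ℝ × ℝ => S.drift f₁ q.1 q.2.1 q.2.2) q := by
  have hD := S.isOpen_D.mem_nhds (S.timeChart_mem hq)
  have hG : ContDiffAt ℝ 1 (fun q : ((Fin k → ℝ) × ℝ) × ℝ × ℝ => S.timeChart q.1) q :=
    ((S.contDiffAt_timeChart hq).of_le one_le_two).comp q contDiffAt_fst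
  have hDG : ContDiffAt ℝ 1 (fun q : ((Fin k → ℝ) × ℝ) × ℝ × ℝ => fderiv ℝ S.timeChart q.1) q :=
    ((S.contDiffAt_timeChart hq).fderiv_right (m := 1) (by norm_num [one_add_one_eq_two])).comp q
      contDiffAt_fst
  have hDI : ContDiffAt ℝ 1
      (fun q : ((Fin k → ℝ) × ℝ) × ℝ × ℝ => fderiv ℝ S.I (S.timeChart q.1)) q :=
    ContDiffAt.comp q ((S.contDiffAt_I (S.timeChart_mem hq)).fderiv_right (m := 1)
      (by norm_num [one_add_one_eq_two])) hG
  have hf : ContDiffAt ℝ 1 (fun q : ((Fin k → ℝ) × ℝ) × ℝ × ℝ => S.f₀ (S.timeChart q.1)) q :=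
    ContDiffAt.comp q ((S.contDiffOn_f₀.contDiffAt hD).of_le one_le_two) hG
  have hv : ContDiffAt ℝ 1
      (fun q : ((Fin k → ℝ) × ℝ) × ℝ × ℝ => f₁ (S.timeChart q.1) q.2.1 q.2.2) q :=
    ContDiffAt.comp q (f := fun q : ((Fin k → ℝ) × ℝ) × ℝ × ℝ => (S.timeChart q.1, q.2.1, q.2.2))
      hf₁ (hG.prodMk contDiffAt_snd)
  have ha := hDI.clm_apply hv
  refine ha.prodMk (ContDiffAt.div (hf.inner ℝ (hv.sub (hDG.clm_apply (ha.prodMk contDiffAt_const))))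
    (hf.norm_sq ℝ) ?_)
  exact pow_ne_zero 2 (norm_ne_zero_iff.2 (S.f₀_ne_zero (S.timeChart_mem hq)))

end PeriodicIntegrableSystem

/-! ### Perturbations of a translation -/

section Averaging

variable {E : Type u} [NormedAddCommGroup E] [NormedSpace ℝ E]

/-- For the equation `z' = e + ε R(z, t, ε)`, the solutions on `[0, τ]` near an unperturbed one have
the form `z + t e + ε w(t)`, where `w(τ)` depends continuously differentiably on `(z, ε)`. -/
theorem exists_scaled_displacement [FiniteDimensional ℝ E] {e : E} {V : Set E} (hV : IsOpen V)
    (hVe : ∀ z ∈ V, ∀ t : ℝ, z + t • e ∈ V) {δ τ : ℝ} (hδ : 0 < δ) (hτ : 0 < τ)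
    {R : E → ℝ → ℝ → E}
    (hR : ∀ z ∈ V, ∀ t, ∀ ε ∈ Ioo (-δ) δ,
      ContDiffAt ℝ 1 (fun q : E × ℝ × ℝ => R q.1 q.2.1 q.2.2) (z, t, ε))
    {z₀ : E} (hz₀ : z₀ ∈ V) :
    ∃ w : E → ℝ → ℝ → E, ContDiffAt ℝ 1 (fun p : E × ℝ => w p.1 p.2 τ) (z₀, 0) ∧
      (∀ᶠ p : E × ℝ in 𝓝 (z₀, 0), w p.1 p.2 0 = 0 ∧ ∀ t ∈ Icc 0 τ,
        p.1 + t • e + p.2 • w p.1 p.2 t ∈ V ∧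
        HasDerivWithinAt (w p.1 p.2) (R (p.1 + t • e + p.2 • w p.1 p.2 t) t p.2) (Icc 0 τ) t) ∧
      ∀ᶠ z in 𝓝 z₀, w z 0 τ = ∫ t in (0 : ℝ)..τ, R (z + t • e) t 0 := by
  have h0δ : (0 : ℝ) ∈ Ioo (-δ) δ := ⟨by linarith, hδ⟩
  have hRcont : ∀ z ∈ V, Continuous fun t : ℝ => R (z + t • e) t 0 := fun z hz =>
    continuous_iff_continuousAt.2 fun t =>
      ContinuousAt.comp (f := fun t : ℝ => (z + t • e, t, (0 : ℝ)))
        (hR _ (hVe z hz t) t 0 h0δ).continuousAt (by fun_prop)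
  -- The state is q = (w, t, z, ε). Carrying time and parameters as components makes the equation
  -- autonomous, and the factor τ in `f` rescales [0, τ] to [0, 1].
  let c : E × ℝ × E × ℝ → E × ℝ × ℝ :=
    fun q => (q.2.2.1 + q.2.1 • e + q.2.2.2 • q.1, q.2.1, q.2.2.2)
  have hc : ContDiff ℝ 1 c := by fun_prop
  let f : E × ℝ × E × ℝ → E × ℝ × E × ℝ :=
    fun q => (τ • R (c q).1 (c q).2.1 (c q).2.2, τ, 0, 0)
  let U : Set (E × ℝ × E × ℝ) := {q | (c q).1 ∈ V ∧ (c q).2.2 ∈ Ioo (-δ) δ}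
  have hU : IsOpen U := (hV.preimage (continuous_fst.comp hc.continuous)).inter
    (isOpen_Ioo.preimage ((continuous_snd.comp continuous_snd).comp hc.continuous))
  have hf : ContDiffOn ℝ 1 f U := fun q hq => by
    have h1 : ContDiffAt ℝ 1 (fun q => R (c q).1 (c q).2.1 (c q).2.2) q :=
      ContDiffAt.comp q (g := fun q : E × ℝ × ℝ => R q.1 q.2.1 q.2.2) (f := c)
        (hR (c q).1 hq.1 (c q).2.1 (c q).2.2 hq.2) hc.contDiffAt
    exact ((contDiffAt_const.smul h1).prodMk contDiffAt_const).contDiffWithinAt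
  let u : ℝ → E × ℝ × E × ℝ :=
    fun s => (∫ t in (0 : ℝ)..τ * s, R (z₀ + t • e) t 0, τ * s, z₀, 0)
  have hu0 : u 0 = (0, 0, z₀, 0) := by simp [u]
  have hu : ∀ s ∈ Icc (0 : ℝ) 1, HasDerivWithinAt u (f (u s)) (Icc 0 1) s := fun s _ => by
    have h1 : HasDerivAt (fun s : ℝ => τ * s) τ s := by simpa using (hasDerivAt_id s).const_mul τ
    have h2 : HasDerivAt (fun s => ∫ t in (0 : ℝ)..τ * s, R (z₀ + t • e) t 0)
        (τ • R (z₀ + (τ * s) • e) (τ * s) 0) s :=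
      HasDerivAt.scomp (g₁ := fun x => ∫ t in (0 : ℝ)..x, R (z₀ + t • e) t 0) s
        ((hRcont z₀ hz₀).integral_hasStrictDerivAt 0 (τ * s)).hasDerivAt h1
    have h3 := (h2.prodMk (h1.prodMk (hasDerivAt_const s (z₀, (0 : ℝ))))).hasDerivWithinAt
      (s := Icc 0 1)
    have h4 : f (u s) = (τ • R (z₀ + (τ * s) • e) (τ * s) 0, τ, 0) := by
      simp only [f, u, c, zero_smul, add_zero]; rfl
    rw [h4]
    exact h3
  have huU : ∀ s ∈ Icc (0 : ℝ) 1, u s ∈ U := fun s _ => by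
    refine ⟨?_, h0δ⟩
    simpa [c, u] using hVe z₀ hz₀ (τ * s)
  obtain ⟨φ, hφs, hφ⟩ := exists_family_of_solutions (n := 1) one_ne_zero hU
    (by exact_mod_cast hf) hu huU
  rw [hu0] at hφs hφ
  let ι : E × ℝ → E × ℝ × E × ℝ := fun p => (0, 0, p.1, p.2)
  have hι : ContDiff ℝ 1 ι := by fun_prop
  have hsol : ∀ᶠ p : E × ℝ in 𝓝 (z₀, 0), (φ (ι p) (0 / τ)).1 = 0 ∧ ∀ t ∈ Icc 0 τ,
        p.1 + t • e + p.2 • (φ (ι p) (t / τ)).1 ∈ V ∧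
        HasDerivWithinAt (fun t => (φ (ι p) (t / τ)).1)
          (R (p.1 + t • e + p.2 • (φ (ι p) (t / τ)).1) t p.2) (Icc 0 τ) t := by
    filter_upwards [hι.continuous.continuousAt.eventually hφ] with p ⟨hp0, hp⟩
    have hsnd : EqOn (fun s => (φ (ι p) s).2) (fun s => (τ * s, p.1, p.2)) (Icc (0 : ℝ) 1) := by
      refine eqOn_of_hasDerivWithinAt_Icc (f := fun _ : ℝ × E × ℝ => (τ, 0, 0)) isOpen_univ
        contDiffOn_const (fun s hs => ⟨mem_univ _, ?_⟩) (fun s _ => ⟨mem_univ _, ?_⟩) ?_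
      · have := (ContinuousLinearMap.snd ℝ E (ℝ × E × ℝ)).hasFDerivAt.comp_hasDerivWithinAt s
          (hp s hs).2
        exact this
      · have h1 : HasDerivAt (fun s : ℝ => τ * s) τ s := by
          simpa using (hasDerivAt_id s).const_mul τ
        exact (h1.prodMk (hasDerivAt_const s (p.1, p.2))).hasDerivWithinAt
      · simp [hp0, ι]
    refine ⟨by simp [hp0, ι], fun t ht => ?_⟩
    have ht' : t / τ ∈ Icc (0 : ℝ) 1 := ⟨div_nonneg ht.1 hτ.le, (div_le_one hτ).2 ht.2⟩
    have h2 : (φ (ι p) (t / τ)).2 = (t, p.1, p.2) := by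
      simpa only [mul_div_cancel₀ _ hτ.ne'] using hsnd ht'
    have hcp : c (φ (ι p) (t / τ)) = (p.1 + t • e + p.2 • (φ (ι p) (t / τ)).1, t, p.2) := by
      simp [c, h2]
    obtain ⟨hmem, hder⟩ := hp _ ht'
    refine ⟨by simpa [U, hcp] using hmem.1, ?_⟩
    have h3 := (ContinuousLinearMap.fst ℝ E (ℝ × E × ℝ)).hasFDerivAt.comp_hasDerivWithinAt _ hder
    have h4 : HasDerivWithinAt (fun t : ℝ => t / τ) τ⁻¹ (Icc 0 τ) t := by
      simpa [div_eq_mul_inv] using ((hasDerivAt_id t).mul_const τ⁻¹).hasDerivWithinAt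
    have hmaps : MapsTo (fun t : ℝ => t / τ) (Icc 0 τ) (Icc 0 1) :=
      fun s hs => ⟨div_nonneg hs.1 hτ.le, (div_le_one hτ).2 hs.2⟩
    have h5 := h3.scomp t h4 hmaps
    have h6 : τ⁻¹ • (ContinuousLinearMap.fst ℝ E (ℝ × E × ℝ)) (f (φ (ι p) (t / τ)))
        = R (p.1 + t • e + p.2 • (φ (ι p) (t / τ)).1) t p.2 := by
      simp only [f, hcp, ContinuousLinearMap.coe_fst']
      rw [smul_smul, inv_mul_cancel₀ hτ.ne', one_smul]
    rw [h6] at h5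
    exact h5
  refine ⟨fun z ε t => (φ (ι (z, ε)) (t / τ)).1, ?_, hsol, ?_⟩
  · simp only [div_self hτ.ne']
    have h1 : ContDiffAt ℝ 1 (fun q => φ q 1) (ι (z₀, 0)) := by exact_mod_cast hφs
    exact contDiff_fst.contDiffAt.comp _ (h1.comp (z₀, (0 : ℝ)) hι.contDiffAt)
  · have hcont : ContinuousAt (fun z : E => (z, (0 : ℝ))) z₀ := by fun_prop
    filter_upwards [hcont.eventually hsol, hV.mem_nhds hz₀] with z hz hzV
    simp only [zero_smul, add_zero] at hz
    have h1 := intervalIntegral.integral_eq_sub_of_hasDeriv_right_of_le hτ.le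
      (f := fun t => (φ (ι (z, 0)) (t / τ)).1) (f' := fun t => R (z + t • e) t 0)
      (fun t ht => (hz.2 t ht).2.continuousWithinAt)
      (fun t ht => ((hz.2 t (Ioo_subset_Icc_self ht)).2.hasDerivAt
        (Icc_mem_nhds ht.1 ht.2)).hasDerivWithinAt)
      ((hRcont z hzV).intervalIntegrable _ _)
    rw [h1]
    simp only [hz.1, sub_zero]

/-- A simple zero of `F(·, 0)` persists for small values of the parameter. -/
theorem exists_tendsto_zero_of_det_ne_zero [FiniteDimensional ℝ E] {F : E × ℝ → E} {z₀ : E}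
    (hF : ContDiffAt ℝ 1 F (z₀, 0)) (h0 : F (z₀, 0) = 0)
    (hdet : (fderiv ℝ (fun z => F (z, 0)) z₀).det ≠ 0) :
    ∃ ζ : ℝ → E, Tendsto ζ (𝓝 0) (𝓝 z₀) ∧ ∀ᶠ ε in 𝓝 (0 : ℝ), F (ζ ε, ε) = 0 := by
  have : CompleteSpace E := FiniteDimensional.complete ℝ E
  let H : ℝ × E → E := fun p => F (p.2, p.1)
  have hH : ContDiffAt ℝ 1 H (0, z₀) :=
    ContDiffAt.comp ((0 : ℝ), z₀) (f := fun p : ℝ × E => (p.2, p.1)) hF (by fun_prop)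
  have hder : fderiv ℝ H (0, z₀) ∘L .inr ℝ ℝ E = fderiv ℝ (fun z => F (z, 0)) z₀ := by
    have h1 := (hH.differentiableAt one_ne_zero).hasFDerivAt
    have h2 : HasFDerivAt (fun z : E => ((0 : ℝ), z)) (ContinuousLinearMap.inr ℝ ℝ E) z₀ :=
      (ContinuousLinearMap.inr ℝ ℝ E).hasFDerivAt
    exact (HasFDerivAt.comp (f := fun z : E => ((0 : ℝ), z)) z₀ h1 h2).fderiv.symm
  have hinv : (fderiv ℝ H (0, z₀) ∘L .inr ℝ ℝ E).IsInvertible := by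
    rw [hder]
    exact ⟨ContinuousLinearMap.toContinuousLinearEquivOfDetNeZero _ hdet, by ext; simp⟩
  have h1 := hH.implicitFunction_apply_self one_ne_zero hinv
  refine ⟨hH.implicitFunction one_ne_zero hinv, ?_, ?_⟩
  · have h2 := (hH.contDiffAt_implicitFunction one_ne_zero hinv).continuousAt
    rw [ContinuousAt, h1] at h2
    exact h2
  · filter_upwards [hH.eventually_apply_implicitFunction one_ne_zero hinv] with ε hε
    exact hε.trans h0

/-- A solution on `[0, τ]` of a `τ`-periodic equation that returns to its initial value extends to
a periodic solution. -/
theorem exists_periodic_solution {g : E → ℝ → E} {U : Set E} {τ : ℝ} (hτ : 0 < τ)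
    (hg : ∀ x ∈ U, ∀ t, g x (t + τ) = g x t) {x : ℝ → E}
    (hx : ∀ t ∈ Icc 0 τ, x t ∈ U ∧ HasDerivWithinAt x (g (x t) t) (Icc 0 τ) t)
    (hx0 : x τ = x 0) :
    ∃ X : ℝ → E, X 0 = x 0 ∧ (∀ t, X t ∈ U ∧ HasDerivAt X (g (X t) t) t) ∧
      Function.Periodic X τ := by
  let X : ℝ → E := fun t => x (toIcoMod hτ 0 t)
  have hper : Function.Periodic X τ := fun t => by simp [X]
  have hXx : ∀ t ∈ Ico 0 τ, X t = x t := fun t ht => by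
    simp only [X]
    rw [(toIcoMod_eq_self hτ).2 (by simpa using ht)]
  have hXx' : ∀ t ∈ Icc (-τ) 0, X t = x (t + τ) := fun t ht => by
    rcases ht.2.eq_or_lt with rfl | h
    · rw [hXx 0 ⟨le_rfl, hτ⟩, zero_add, hx0]
    · rw [← hper t, hXx (t + τ) ⟨by linarith [ht.1], by linarith⟩]
  have hbase : ∀ s ∈ Ico 0 τ, X s ∈ U ∧ HasDerivAt X (g (X s) s) s := fun s hs => by
    obtain ⟨hmem, hder⟩ := hx s (Ico_subset_Icc_self hs)
    rw [hXx s hs]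
    refine ⟨hmem, ?_⟩
    rcases hs.1.eq_or_lt with rfl | h
    -- At the gluing point the left derivative comes from the end τ of the interval, by periodicity
    -- of g and x τ = x 0.
    · have hright : HasDerivWithinAt X (g (x 0) 0) (Ici 0) 0 := by
        refine (hder.mono_of_mem_nhdsWithin (Icc_mem_nhdsGE hτ)).congr_of_eventuallyEq ?_ (hXx 0 hs)
        filter_upwards [Ico_mem_nhdsGE hτ] with t ht using hXx t ht
      have hleft : HasDerivWithinAt X (g (x 0) 0) (Iic 0) 0 := by
        have h1 := (hx τ (right_mem_Icc.2 hτ.le)).2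
        rw [hx0, ← zero_add τ, hg _ (hx 0 (left_mem_Icc.2 hτ.le)).1, zero_add] at h1
        have h2 : HasDerivWithinAt (fun t => x (t + τ)) (g (x 0) 0) (Icc (-τ) 0) 0 := by
          have h3 : HasDerivWithinAt (fun t : ℝ => t + τ) 1 (Icc (-τ) 0) 0 :=
            ((hasDerivAt_id (0 : ℝ)).add_const τ).hasDerivWithinAt
          have h4 : HasDerivWithinAt x (g (x 0) 0) (Icc 0 τ) ((fun t : ℝ => t + τ) 0) := by
            simpa using h1
          have hmaps : MapsTo (fun t : ℝ => t + τ) (Icc (-τ) 0) (Icc 0 τ) :=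
            fun t ht => ⟨by linarith [ht.1], by linarith [ht.2]⟩
          have := h4.scomp (0 : ℝ) h3 hmaps
          simpa [Function.comp_def] using this
        refine (h2.mono_of_mem_nhdsWithin (Icc_mem_nhdsLE (by linarith))).congr_of_eventuallyEq ?_
          (hXx' 0 ⟨by linarith, le_rfl⟩)
        filter_upwards [Icc_mem_nhdsLE (show -τ < 0 by linarith)] with t ht using hXx' t ht
      have := hleft.union hright
      rwa [Iic_union_Ici, hasDerivWithinAt_univ] at this
    · refine (hder.hasDerivAt (Icc_mem_nhds h hs.2)).congr_of_eventuallyEq ?_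
      filter_upwards [Ioo_mem_nhds h hs.2] with t ht using hXx t (Ioo_subset_Ico_self ht)
  refine ⟨X, hXx 0 ⟨le_rfl, hτ⟩, fun t => ?_, hper⟩
  have hs : toIcoMod hτ 0 t ∈ Ico 0 τ := by simpa using toIcoMod_mem_Ico hτ 0 t
  obtain ⟨hmem, hder⟩ := hbase _ hs
  have hadd : toIcoMod hτ 0 t = t - toIcoDiv hτ 0 t * τ := by
    rw [toIcoMod, zsmul_eq_mul]
  have hXt : X (toIcoMod hτ 0 t) = X t := by
    rw [hadd]; exact hper.sub_int_mul_eq _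
  rw [hXt] at hmem hder
  have hgt : g (X t) (toIcoMod hτ 0 t) = g (X t) t := by
    rw [hadd]
    exact Function.Periodic.sub_int_mul_eq (f := g (X t)) (fun s => hg _ hmem s) _
  rw [hgt, hadd] at hder
  have := hder.comp_sub_const t (toIcoDiv hτ 0 t * τ)
  refine ⟨hmem, this.congr_of_eventuallyEq (Eventually.of_forall fun s => ?_)⟩
  exact (hper.sub_int_mul_eq _).symm

end Averaging

/-! ### Perturbed solutions and the Melnikov vector in the time chart -/

namespace PeriodicIntegrableSystem

variable {k : ℕ} (S : PeriodicIntegrableSystem k)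

/-- The change of variables from `(I, θ)` to the coordinates used by `timeChart`. -/
noncomputable def angleToTime (T : ℝ) (z : (Fin k → ℝ) × ℝ) : (Fin k → ℝ) × ℝ :=
  (z.1, S.period z.1 / T * z.2)

lemma contDiffAt_angleToTime (T : ℝ) {z : (Fin k → ℝ) × ℝ} (hz : z.1 ∈ S.Lam) :
    ContDiffAt ℝ 1 (S.angleToTime T) z :=
  contDiffAt_fst.prodMk
    (((ContDiffAt.comp z (S.contDiffAt_period hz) contDiffAt_fst).div_const T).mul contDiffAt_snd)

lemma orbit_eq_timeChart {T : ℝ} (hT : T ≠ 0) {z : (Fin k → ℝ) × ℝ} (hz : z.1 ∈ S.Lam) (t : ℝ) :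
    S.orbit T z t = S.timeChart (S.angleToTime T z + t • (0, 1)) := by
  have hP := (S.period_pos hz).ne'
  have : S.period z.1 / T * (z.2 + T / S.period z.1 * t) = S.period z.1 / T * z.2 + t := by
    field_simp
  simp [orbit, G, timeChart, angleToTime, Omega, this]

lemma hasDerivWithinAt_timeChart_comp (f₁ : Phase k → ℝ → ℝ → Phase k) {ζ : (Fin k → ℝ) × ℝ}
    {ε t : ℝ} {w : ℝ → (Fin k → ℝ) × ℝ} {s : Set ℝ}
    (hmem : (ζ + t • ((0, 1) : (Fin k → ℝ) × ℝ) + ε • w t).1 ∈ S.Lam)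
    (hw : HasDerivWithinAt w (S.drift f₁ (ζ + t • (0, 1) + ε • w t) t ε) s t) :
    HasDerivWithinAt (fun t => S.timeChart (ζ + t • (0, 1) + ε • w t))
      (S.f₀ (S.timeChart (ζ + t • (0, 1) + ε • w t))
        + ε • f₁ (S.timeChart (ζ + t • (0, 1) + ε • w t)) t ε) s t := by
  have h1 : HasDerivWithinAt (fun t : ℝ => ζ + t • ((0, 1) : (Fin k → ℝ) × ℝ) + ε • w t)
      ((0, 1) + ε • S.drift f₁ (ζ + t • (0, 1) + ε • w t) t ε) s t := by
    have h2 : HasDerivWithinAt (fun t : ℝ => ζ + t • ((0, 1) : (Fin k → ℝ) × ℝ)) (0, 1) s t := by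
      simpa using ((hasDerivAt_id t).smul_const
        ((0, 1) : (Fin k → ℝ) × ℝ)).const_add ζ |>.hasDerivWithinAt (s := s)
    exact h2.add (hw.const_smul ε)
  have h3 := HasFDerivAt.comp_hasDerivWithinAt
    (f := fun t : ℝ => ζ + t • ((0, 1) : (Fin k → ℝ) × ℝ) + ε • w t) t
    (S.hasFDerivAt_timeChart hmem) h1
  rw [map_add, map_smul, S.fderiv_timeChart_time hmem, S.fderiv_timeChart_drift f₁ hmem] at h3
  exact h3

/-! ### The Melnikov vector as an integral of the perturbation in coordinates -/

section Melnikov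

variable {f₁ : Phase k → ℝ → ℝ → Phase k} {T : ℝ}

lemma continuous_orbit (hT : T ≠ 0) {z : (Fin k → ℝ) × ℝ} (hz : z.1 ∈ S.Lam) :
    Continuous (S.orbit T z) := by
  refine continuous_iff_continuousAt.2 fun t => ?_
  have h1 : (S.angleToTime T z + t • ((0, 1) : (Fin k → ℝ) × ℝ)).1 ∈ S.Lam := by
    simpa [angleToTime] using hz
  rw [funext (S.orbit_eq_timeChart hT hz)]
  exact ContinuousAt.comp (f := fun t : ℝ => S.angleToTime T z + t • ((0, 1) : (Fin k → ℝ) × ℝ))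
    (S.contDiffAt_timeChart h1).continuousAt (by fun_prop)

lemma orbit_mem (hT : T ≠ 0) {z : (Fin k → ℝ) × ℝ} (hz : z.1 ∈ S.Lam) (t : ℝ) :
    S.orbit T z t ∈ S.D := by
  rw [S.orbit_eq_timeChart hT hz]
  exact S.timeChart_mem (by simpa [angleToTime] using hz)

lemma continuous_drift
    (hf₁ : ∀ x ∈ S.D, ∀ t, ContDiffAt ℝ 1 (fun p : Phase k × ℝ × ℝ => f₁ p.1 p.2.1 p.2.2) (x, t, 0))
    {ζ : (Fin k → ℝ) × ℝ} (hζ : ζ.1 ∈ S.Lam) :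
    Continuous fun t : ℝ => S.drift f₁ (ζ + t • (0, 1)) t 0 := by
  refine continuous_iff_continuousAt.2 fun t => ?_
  have h1 : (ζ + t • ((0, 1) : (Fin k → ℝ) × ℝ)).1 ∈ S.Lam := by simpa using hζ
  exact ContinuousAt.comp
    (f := fun t : ℝ => (ζ + t • ((0, 1) : (Fin k → ℝ) × ℝ), t, (0 : ℝ)))
    (g := fun q : ((Fin k → ℝ) × ℝ) × ℝ × ℝ => S.drift f₁ q.1 q.2.1 q.2.2)
    (S.contDiffAt_drift (q := (ζ + t • ((0, 1) : (Fin k → ℝ) × ℝ), t, (0 : ℝ)))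
      (hf₁ _ (S.timeChart_mem h1) t) h1).continuousAt (by fun_prop)

lemma integral_drift_fst (hT : T ≠ 0)
    (hf₁ : ∀ x ∈ S.D, ∀ t, ContDiffAt ℝ 1 (fun p : Phase k × ℝ × ℝ => f₁ p.1 p.2.1 p.2.2) (x, t, 0))
    (n : ℕ) {z : (Fin k → ℝ) × ℝ} (hz : z.1 ∈ S.Lam) :
    (∫ t in (0 : ℝ)..(n * T), S.drift f₁ (S.angleToTime T z + t • (0, 1)) t 0).1
      = S.melnikovI f₁ T n z := by
  ext i
  have h1 := ContinuousLinearMap.intervalIntegral_comp_comm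
    ((ContinuousLinearMap.proj (R := ℝ) (φ := fun _ : Fin k => ℝ) i).comp
      (ContinuousLinearMap.fst ℝ (Fin k → ℝ) ℝ))
    ((S.continuous_drift hf₁ (ζ := S.angleToTime T z) hz).intervalIntegrable
      (μ := MeasureTheory.volume) 0 (n * T))
  refine h1.symm.trans (intervalIntegral.integral_congr fun t _ => ?_)
  simp [drift, dIf, S.orbit_eq_timeChart hT hz]

lemma integral_drift_snd
    (hf₁ : ∀ x ∈ S.D, ∀ t, ContDiffAt ℝ 1 (fun p : Phase k × ℝ × ℝ => f₁ p.1 p.2.1 p.2.2) (x, t, 0))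
    (τ : ℝ) {ζ : (Fin k → ℝ) × ℝ} (hζ : ζ.1 ∈ S.Lam) :
    (∫ t in (0 : ℝ)..τ, S.drift f₁ (ζ + t • (0, 1)) t 0).2
      = ∫ t in (0 : ℝ)..τ, (S.drift f₁ (ζ + t • (0, 1)) t 0).2 :=
  (ContinuousLinearMap.intervalIntegral_comp_comm (ContinuousLinearMap.snd ℝ (Fin k → ℝ) ℝ)
    ((S.continuous_drift hf₁ hζ).intervalIntegrable (μ := MeasureTheory.volume) 0 τ)).symm

/-- The partial derivatives of `G` when the period is locally constant. -/
lemma dG_eq (hT : T ≠ 0) {z : (Fin k → ℝ) × ℝ} (hz : z.1 ∈ S.Lam)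
    (hP : ∀ᶠ ξ in 𝓝 z.1, S.period ξ = S.period z.1) (t : ℝ) (i : Fin k) :
    S.dG T i (z.1, z.2 + S.Omega T z.1 * t)
      = fderiv ℝ S.timeChart (S.angleToTime T z + t • (0, 1)) (Pi.single i 1, 0) := by
  have hP0 := (S.period_pos hz).ne'
  set s := S.period z.1 / T * z.2 + t with hs
  have hs' : S.period z.1 / T * (z.2 + T / S.period z.1 * t) = s := by rw [hs]; field_simp
  have hzs : S.angleToTime T z + t • ((0, 1) : (Fin k → ℝ) × ℝ) = (z.1, s) := by
    simp [angleToTime, hs]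
  have h1 : HasFDerivAt (fun ξ : Fin k → ℝ => (ξ, s)) (ContinuousLinearMap.inl ℝ (Fin k → ℝ) ℝ) z.1 :=
    hasFDerivAt_prodMk_left z.1 s
  have h2 : HasFDerivAt (fun ξ => S.timeChart (ξ, s))
      ((fderiv ℝ S.timeChart (z.1, s)).comp (ContinuousLinearMap.inl ℝ (Fin k → ℝ) ℝ)) z.1 :=
    HasFDerivAt.comp (f := fun ξ : Fin k → ℝ => (ξ, s)) z.1
      (S.hasFDerivAt_timeChart (z := (z.1, s)) hz) h1
  have h3 : HasFDerivAt (fun ξ => S.G T (ξ, z.2 + S.Omega T z.1 * t))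
      ((fderiv ℝ S.timeChart (z.1, s)).comp (ContinuousLinearMap.inl ℝ (Fin k → ℝ) ℝ)) z.1 := by
    refine h2.congr_of_eventuallyEq ?_
    -- A varying period would add a multiple of f₀ here, because θ is converted to time by the
    -- factor P(ξ)/T.
    filter_upwards [hP] with ξ hξ
    simp only [G, timeChart, Omega, hξ, hs']
  rw [hzs]
  simp only [dG]
  rw [h3.fderiv]
  simp

/-- Since dΩ/dI vanishes, the double integral drops out. Since P is locally constant, `dG` is the
I-derivative of `timeChart`, so the two remaining integrands combine to Ω times the time component
of `drift`. -/
lemma Omega_mul_integral_drift_snd (hT : T ≠ 0)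
    (hf₁ : ∀ x ∈ S.D, ∀ t, ContDiffAt ℝ 1 (fun p : Phase k × ℝ × ℝ => f₁ p.1 p.2.1 p.2.2) (x, t, 0))
    (n : ℕ) {z : (Fin k → ℝ) × ℝ} (hz : z.1 ∈ S.Lam)
    (hΩ : fderiv ℝ (S.Omega T) z.1 = 0)
    (hP : ∀ᶠ ξ in 𝓝 z.1, S.period ξ = S.period z.1) :
    S.Omega T z.1 * (∫ t in (0 : ℝ)..(n * T), S.drift f₁ (S.angleToTime T z + t • (0, 1)) t 0).2
      = S.melnikovTheta f₁ T n z := by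
  set A : ℝ → ℝ := fun t => S.Omega T z.1 *
    (inner ℝ (S.f₀ (S.orbit T z t)) (f₁ (S.orbit T z t) t 0) / ‖S.f₀ (S.orbit T z t)‖ ^ 2) with hA
  set d : ℝ → ℝ := fun t => S.Omega T z.1 * (S.drift f₁ (S.angleToTime T z + t • (0, 1)) t 0).2
    with hd
  have hcd : Continuous d := continuous_const.mul
    (continuous_snd.comp (S.continuous_drift hf₁ (ζ := S.angleToTime T z) hz))
  have hcA : Continuous A := by
    have hc := S.continuous_orbit hT hz
    have hc0 : Continuous fun t => S.f₀ (S.orbit T z t) := continuous_iff_continuousAt.2 fun t =>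
      ContinuousAt.comp (S.contDiffOn_f₀.contDiffAt
        (S.isOpen_D.mem_nhds (S.orbit_mem hT hz t))).continuousAt hc.continuousAt
    have hc1 : Continuous fun t => f₁ (S.orbit T z t) t 0 := continuous_iff_continuousAt.2 fun t =>
      ContinuousAt.comp (f := fun t : ℝ => (S.orbit T z t, t, (0 : ℝ)))
        (g := fun p : Phase k × ℝ × ℝ => f₁ p.1 p.2.1 p.2.2)
        (hf₁ _ (S.orbit_mem hT hz t) t).continuousAt (by fun_prop)
    refine continuous_const.mul ((hc0.inner hc1).div (hc0.norm.pow 2) fun t => ?_)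
    exact pow_ne_zero 2 (norm_ne_zero_iff.2 (S.f₀_ne_zero (S.orbit_mem hT hz t)))
  have hpt : ∀ t, S.Omega T z.1 *
      ∑ i, inner ℝ (S.f₀ (S.orbit T z t)) (S.dG T i (z.1, z.2 + S.Omega T z.1 * t)) /
        ‖S.f₀ (S.orbit T z t)‖ ^ 2 * S.dIf f₁ T z i t = A t - d t := fun t => by
    have hsum : ∀ (L : (Fin k → ℝ) × ℝ →L[ℝ] Phase k) (a : Fin k → ℝ),
        L (a, 0) = ∑ i, a i • L (Pi.single i 1, 0) := fun L a => by
      have h1 : ((a, 0) : (Fin k → ℝ) × ℝ)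
          = ∑ i, a i • ((Pi.single i 1, 0) : (Fin k → ℝ) × ℝ) := by
        refine Prod.ext ?_ (by simp [Prod.snd_sum])
        rw [Prod.fst_sum]
        simpa using pi_eq_sum_univ' a
      rw [h1, map_sum]
      simp only [map_smul]
    simp only [hA, hd, drift, S.dG_eq hT hz hP]
    rw [hsum]
    simp only [dIf, S.orbit_eq_timeChart hT hz]
    rw [← mul_sub, inner_sub_right, sub_div, sub_sub_cancel, inner_sum, Finset.sum_div]
    congr 1
    refine Finset.sum_congr rfl fun i _ => ?_
    rw [inner_smul_right]
    ring
  rw [melnikovTheta, hΩ, S.integral_drift_snd hf₁ _ (ζ := S.angleToTime T z) hz]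
  simp only [hpt]
  rw [intervalIntegral.integral_sub (hcA.intervalIntegrable _ _) (hcd.intervalIntegrable _ _),
    ← intervalIntegral.integral_const_mul]
  change (∫ t in (0 : ℝ)..(n * T), d t) = _ + (∫ t in (0 : ℝ)..(n * T), A t) - _
  simp

end Melnikov

/-- If the frequency is stationary near `ξ`, the period is constant near `ξ`. -/
lemma eventually_period_eq {T : ℝ} (hT : T ≠ 0) {ξ : Fin k → ℝ} (hξ : ξ ∈ S.Lam)
    (h : ∀ᶠ ξ' in 𝓝 ξ, fderiv ℝ (S.Omega T) ξ' = 0) :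
    ∀ᶠ ξ' in 𝓝 ξ, S.period ξ' = S.period ξ := by
  obtain ⟨r, hr, hball⟩ := Metric.mem_nhds_iff.1 (h.and (S.isOpen_Lam.mem_nhds hξ))
  filter_upwards [Metric.ball_mem_nhds ξ hr] with ξ' hξ'
  have hΩ : S.Omega T ξ' = S.Omega T ξ :=
    Metric.isOpen_ball.is_const_of_fderiv_eq_zero (𝕜 := ℝ) (convex_ball ξ r).isPreconnected
      (fun y hy => ((S.contDiffAt_Omega T (hball hy).2).differentiableAt
        one_ne_zero).differentiableWithinAt)
      (fun y hy => (hball hy).1) hξ' (Metric.mem_ball_self hr)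
  have h1 := (S.period_pos hξ).ne'
  have h2 := (S.period_pos (hball hξ').2).ne'
  simp only [Omega] at hΩ
  field_simp at hΩ
  exact hΩ.symm

end PeriodicIntegrableSystem

/-! ### The bifurcation equation and its solution in the two cases -/

theorem theorem1 {k : ℕ} (S : PeriodicIntegrableSystem k)
    (f₁ : Phase k → ℝ → ℝ → Phase k) (T δ : ℝ) (hT : 0 < T) (hδ : 0 < δ)
    (hf₁ : ContDiffOn ℝ 2 (fun p : Phase k × ℝ × ℝ => f₁ p.1 p.2.1 p.2.2)
      (S.D ×ˢ (univ : Set ℝ) ×ˢ Ioo (-δ) δ))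
    (hper : ∀ x ∈ S.D, ∀ t, ∀ ε ∈ Ioo (-δ) δ, f₁ x (t + T) ε = f₁ x t ε)
    (z : (Fin k → ℝ) × ℝ) (hz : z.1 ∈ S.Lam)
    (m n : ℕ) (hm : 0 < m) (hn : 0 < n) (hres : (m : ℝ) * S.period z.1 = n * T)
    (hM : S.NonDegenerate f₁ T n z ∨ S.Degenerate f₁ T n z) :
    ∃ x₀ : ℝ → Phase k, Tendsto x₀ (𝓝[>] 0) (𝓝 (S.G T z)) ∧
      ∀ᶠ ε in 𝓝[>] (0 : ℝ), ∃ x : ℝ → Phase k, x 0 = x₀ ε ∧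
        (∀ t, x t ∈ S.D ∧ HasDerivAt x (S.f₀ (x t) + ε • f₁ (x t) t ε) t) ∧
        Function.Periodic x (n * T) := by
  have hf₁' : ∀ x ∈ S.D, ∀ t, ∀ ε ∈ Ioo (-δ) δ,
      ContDiffAt ℝ 1 (fun p : Phase k × ℝ × ℝ => f₁ p.1 p.2.1 p.2.2) (x, t, ε) := fun x hx t ε hε =>
    (hf₁.contDiffAt ((S.isOpen_D.prod (isOpen_univ.prod isOpen_Ioo)).mem_nhds
      ⟨hx, mem_univ _, hε⟩)).of_le one_le_two
  have h0δ : (0 : ℝ) ∈ Ioo (-δ) δ := ⟨by linarith, hδ⟩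
  have hf₁0 := fun x hx t => hf₁' x hx t 0 h0δ
  have hτ : 0 < n * T := by positivity
  set V : Set ((Fin k → ℝ) × ℝ) := {ζ | ζ.1 ∈ S.Lam} with hV
  have hVo : IsOpen V := S.isOpen_Lam.preimage continuous_fst
  obtain ⟨w, hws, hw, hw0⟩ := exists_scaled_displacement (e := ((0, 1) : (Fin k → ℝ) × ℝ)) hVo
    (fun ζ hζ t => by simpa [hV] using hζ) hδ hτ (R := S.drift f₁)
    (fun ζ hζ t ε hε => S.contDiffAt_drift (q := (ζ, t, ε))
      (hf₁' _ (S.timeChart_mem hζ) t ε hε) hζ) (z₀ := S.angleToTime T z) hz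
  have hψ := S.contDiffAt_angleToTime T hz
  -- the displacement in the variables `(I, θ)` and its value for vanishing perturbation
  set W : ((Fin k → ℝ) × ℝ) × ℝ → (Fin k → ℝ) × ℝ :=
    fun p => w (S.angleToTime T p.1) p.2 (n * T) with hW
  have hWs : ContDiffAt ℝ 1 W (z, 0) :=
    ContDiffAt.comp (z, (0 : ℝ)) (g := fun p : ((Fin k → ℝ) × ℝ) × ℝ => w p.1 p.2 (n * T))
      (f := fun p : ((Fin k → ℝ) × ℝ) × ℝ => (S.angleToTime T p.1, p.2)) hws
      ((ContDiffAt.comp (z, (0 : ℝ)) (g := S.angleToTime T) hψ contDiffAt_fst).prodMk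
        contDiffAt_snd)
  have hΩs : ContDiffAt ℝ 1 (fun p : ((Fin k → ℝ) × ℝ) × ℝ => S.Omega T p.1.1) (z, 0) :=
    ContDiffAt.comp (z, (0 : ℝ)) (g := S.Omega T) (S.contDiffAt_Omega T hz)
      (contDiffAt_fst.fst)
  have hVz : ∀ᶠ y : (Fin k → ℝ) × ℝ in 𝓝 z, y.1 ∈ S.Lam := hVo.mem_nhds hz
  have hW0 : ∀ᶠ y in 𝓝 z, W (y, 0)
      = ∫ t in (0 : ℝ)..(n * T), S.drift f₁ (S.angleToTime T y + t • (0, 1)) t 0 :=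
    hψ.continuousAt.eventually hw0
  -- reduction to a bifurcation equation
  suffices h : ∃ ζ : ℝ → (Fin k → ℝ) × ℝ, Tendsto ζ (𝓝 0) (𝓝 z) ∧ ∀ᶠ ε in 𝓝 (0 : ℝ),
      (W (ζ ε, ε)).1 = 0 ∧ n * T + ε * (W (ζ ε, ε)).2 = m * S.period (ζ ε).1 by
    obtain ⟨ζ, hζ, hζW⟩ := h
    have hG : ContinuousAt (S.G T) z :=
      ContinuousAt.comp (g := S.timeChart) (f := S.angleToTime T)
        (S.contDiffAt_timeChart (z := S.angleToTime T z) hz).continuousAt hψ.continuousAt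
    refine ⟨fun ε => S.G T (ζ ε), (hG.tendsto.comp hζ).mono_left nhdsWithin_le_nhds, ?_⟩
    have hpair : Tendsto (fun ε => (S.angleToTime T (ζ ε), ε)) (𝓝 0) (𝓝 (S.angleToTime T z, 0)) :=
      (hψ.continuousAt.tendsto.comp hζ).prodMk_nhds tendsto_id
    refine Eventually.filter_mono nhdsWithin_le_nhds ?_
    filter_upwards [hζW, hpair.eventually hw, hζ.eventually hVz, Ioo_mem_nhds h0δ.1 h0δ.2]
      with ε ⟨hI, hθ⟩ ⟨hwz, hsol⟩ hLam hε
    have key := exists_periodic_solution (g := fun x t => S.f₀ x + ε • f₁ x t ε) (U := S.D) hτ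
      (fun x hx t => by
        have : Function.Periodic (fun t => f₁ x t ε) T := fun t => hper x hx t ε hε
        simp only [this.nat_mul n t])
      (x := fun t => S.timeChart (S.angleToTime T (ζ ε) + t • (0, 1)
        + ε • w (S.angleToTime T (ζ ε)) ε t))
      (fun t ht => ⟨S.timeChart_mem (hsol t ht).1,
        S.hasDerivWithinAt_timeChart_comp f₁ (hsol t ht).1 (hsol t ht).2⟩) ?_
    · obtain ⟨X, hX0, hX, hXp⟩ := key
      refine ⟨X, ?_, hX, hXp⟩
      rw [hX0, hwz]
      simp [PeriodicIntegrableSystem.G, PeriodicIntegrableSystem.timeChart,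
        PeriodicIntegrableSystem.angleToTime]
    -- At time nT the integrals have returned and the time coordinate has advanced by exactly m
    -- periods.
    · have h1 : S.angleToTime T (ζ ε) + (n * T) • ((0, 1) : (Fin k → ℝ) × ℝ)
          + ε • w (S.angleToTime T (ζ ε)) ε (n * T)
          = ((S.angleToTime T (ζ ε)).1,
              (S.angleToTime T (ζ ε)).2 + m * S.period (S.angleToTime T (ζ ε)).1) := by
        refine Prod.ext ?_ ?_
        · have : (w (S.angleToTime T (ζ ε)) ε (n * T)).1 = 0 := hI
          simp [this]
        · have : n * T + ε * (w (S.angleToTime T (ζ ε)) ε (n * T)).2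
            = m * S.period (S.angleToTime T (ζ ε)).1 := hθ
          simp only [Prod.snd_add, Prod.smul_snd, smul_eq_mul, mul_one]
          rw [add_assoc, this]
      simp only [h1, hwz, zero_smul, smul_zero, add_zero]
      exact S.timeChart_add_period (z := S.angleToTime T (ζ ε)) hLam m
  have hn0 : (n : ℝ) ≠ 0 := by positivity
  rcases hM with ⟨-, hMI, hdet⟩ | ⟨hΩ0, hMI, hMθ, hdet⟩
  -- The second component is nT + ε w_s - mP divided by nP, so that it reduces to Ω - m/n at ε = 0.
  · let F : ((Fin k → ℝ) × ℝ) × ℝ → (Fin k → ℝ) × ℝ := fun p =>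
      ((W p).1, S.Omega T p.1.1 * (1 + p.2 * (W p).2 / (n * T)) - m / n)
    have hFs : ContDiffAt ℝ 1 F (z, 0) :=
      hWs.fst.prodMk ((hΩs.mul (contDiffAt_const.add
        ((contDiffAt_snd.mul hWs.snd).div_const _))).sub contDiffAt_const)
    have hF0 : (fun y => F (y, 0)) =ᶠ[𝓝 z]
        fun y => (S.melnikovI f₁ T n y, S.Omega T y.1) - (0, (m / n : ℝ)) := by
      filter_upwards [hW0, hVz] with y hy hyL
      refine Prod.ext ?_ ?_
      · simp only [F, hy, Prod.fst_sub, sub_zero]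
        exact S.integral_drift_fst hT.ne' hf₁0 n hyL
      · simp [F]
    obtain ⟨ζ, hζ, hζF⟩ := exists_tendsto_zero_of_det_ne_zero hFs
      (by
        refine hF0.self_of_nhds.trans ?_
        refine Prod.ext (funext fun i => by simpa using hMI i) ?_
        have hP := (S.period_pos hz).ne'
        simp only [Prod.snd_sub, Prod.snd_zero, PeriodicIntegrableSystem.Omega]
        field_simp
        linarith)
      (by rwa [hF0.fderiv_eq, fderiv_sub_const])
    refine ⟨ζ, hζ, ?_⟩
    filter_upwards [hζF, hζ.eventually hVz] with ε hε hL
    obtain ⟨h1, h2⟩ := Prod.ext_iff.1 hε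
    refine ⟨h1, ?_⟩
    have hP := (S.period_pos hL).ne'
    simp only [F, PeriodicIntegrableSystem.Omega, Prod.snd_zero] at h2
    field_simp at h2
    linarith
  · have hPc := S.eventually_period_eq hT.ne' hz hΩ0
    -- As mP = nT near I_0, the closing condition holds once w_s = 0. The non-zero factor Ω makes
    -- F(·, 0) equal to the Melnikov vector.
    let F : ((Fin k → ℝ) × ℝ) × ℝ → (Fin k → ℝ) × ℝ := fun p =>
      ((W p).1, S.Omega T p.1.1 * (W p).2)
    have hFs : ContDiffAt ℝ 1 F (z, 0) := hWs.fst.prodMk (hΩs.mul hWs.snd)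
    -- The identification with the Melnikov vector is needed on a neighbourhood, since the
    -- derivatives at z are compared.
    have hnear : ∀ᶠ y : (Fin k → ℝ) × ℝ in 𝓝 z,
        fderiv ℝ (S.Omega T) y.1 = 0 ∧ ∀ᶠ ξ in 𝓝 y.1, S.period ξ = S.period y.1 := by
      have h1 : ∀ᶠ y : (Fin k → ℝ) × ℝ in 𝓝 z, ∀ᶠ ξ in 𝓝 y.1, fderiv ℝ (S.Omega T) ξ = 0 :=
        continuous_fst.continuousAt.eventually (eventually_eventually_nhds.2 hΩ0)
      filter_upwards [h1, hVz] with y hy hyL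
      exact ⟨hy.self_of_nhds, S.eventually_period_eq hT.ne' hyL hy⟩
    have hF0 : (fun y => F (y, 0)) =ᶠ[𝓝 z]
        fun y => (S.melnikovI f₁ T n y, S.melnikovTheta f₁ T n y) := by
      filter_upwards [hW0, hVz, hnear] with y hy hyL ⟨hyΩ, hyP⟩
      simp only [F, hy]
      exact Prod.ext (S.integral_drift_fst hT.ne' hf₁0 n hyL)
        (S.Omega_mul_integral_drift_snd hT.ne' hf₁0 n hyL hyΩ hyP)
    obtain ⟨ζ, hζ, hζF⟩ := exists_tendsto_zero_of_det_ne_zero hFs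
      (by
        refine hF0.self_of_nhds.trans ?_
        exact Prod.ext (funext hMI) hMθ)
      (by rwa [hF0.fderiv_eq])
    refine ⟨ζ, hζ, ?_⟩
    have hPζ : ∀ᶠ y : (Fin k → ℝ) × ℝ in 𝓝 z, S.period y.1 = S.period z.1 :=
      continuous_fst.continuousAt.eventually hPc
    filter_upwards [hζF, hζ.eventually hVz, hζ.eventually hPζ] with ε hε hL hPε
    obtain ⟨h1, h2⟩ := Prod.ext_iff.1 hε
    refine ⟨h1, ?_⟩
    have hΩ : S.Omega T (ζ ε).1 ≠ 0 := div_ne_zero hT.ne' (S.period_pos hL).ne'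
    have h3 : (W (ζ ε, ε)).2 = 0 := (mul_eq_zero.1 h2).resolve_left hΩ
    rw [h3, hPε, hres, mul_zero, add_zero]
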